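/- Let $I=[-1,1]$ and $n\ge 1$. A homeomorphism $f\colon I^n\to I^n$ is called piecewise-linear (PL) if there is a finite triangulation of $I^n$ (a finite geometric simplicial complex in $\mathbb{R}^n$ with underlying space $I^n$) such that $f$ is affine on each simplex of the triangulation. Let $\mathrm{PL}(I^n,\partial I^n)$ be the set of all PL homeomorphisms of $I^n$ onto itself that leave every point of the boundary $\partial I^n$ fixed. Then, for every $n\ge 1$, $\mathrm{PL}(I^n,\partial I^n)$ is a group under composition, and this group is locally indicable (every nontrivial finitely generated subgroup admits a surjective homomorphism onto $\mathbb{Z}$), and therefore left-orderable (it carries a strict total ordering $<$ such that $g<h$ implies $fg<fh$ for all $f,g,h$). -/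

import Mathlib

/-- A group is locally indicable if each of its nontrivial finitely generated subgroups is
indicable, i.e. has the group of integers as a quotient. -/
def IsLocallyIndicable (G : Type*) [Group G] : Prop :=
  ∀ H : Subgroup G, H.FG → H ≠ ⊥ → ∃ φ : H →* Multiplicative ℤ, Function.Surjective φ

/-- A group is left-orderable if it carries a strict total ordering that is invariant under
left multiplication. -/
def IsLeftOrderable (G : Type*) [Group G] : Prop :=
  ∃ lt : G → G → Prop, IsStrictTotalOrder G lt ∧ ∀ f g h : G, lt g h → lt (f * g) (f * h)

/-- The cube `Iⁿ` in `ℝⁿ`, where `I = [-1, 1]`. -/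
def cube (n : ℕ) : Set (Fin n → ℝ) :=
  {x | ∀ i, x i ∈ Set.Icc (-1 : ℝ) 1}

/-- A finite triangulation of a subset `X` of `ℝⁿ`: a finite geometric simplicial complex whose
underlying space is `X`. -/
def IsFiniteTriangulation {n : ℕ} (K : Geometry.SimplicialComplex ℝ (Fin n → ℝ))
    (X : Set (Fin n → ℝ)) : Prop :=
  K.faces.Finite ∧ K.space = X

/-- A homeomorphism of the cube is piecewise linear if there is a finite triangulation of the
cube such that it is affine on each simplex of the triangulation. -/
def IsPL {n : ℕ} (f : cube n ≃ₜ cube n) : Prop :=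
  ∃ K : Geometry.SimplicialComplex ℝ (Fin n → ℝ), IsFiniteTriangulation K (cube n) ∧
    ∀ s ∈ K.faces, ∃ A : (Fin n → ℝ) →ᵃ[ℝ] (Fin n → ℝ),
      ∀ x : cube n, (x : Fin n → ℝ) ∈ convexHull ℝ (s : Set (Fin n → ℝ)) →
        (f x : Fin n → ℝ) = A x

/-- The homeomorphism `f` leaves the boundary of the cube pointwise fixed. -/
def FixesBoundary {n : ℕ} (f : cube n ≃ₜ cube n) : Prop :=
  ∀ x : cube n, (x : Fin n → ℝ) ∈ frontier (cube n) → f x = x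

/-!
# Local indicability of the group of PL homeomorphisms of a cube

Extend each homeomorphism in `PL(Iⁿ, ∂Iⁿ)` by the identity to a homeomorphism of `ℝⁿ`, and let
finitely many of them, not all trivial, generate a group. Let `U` be the interior of their common
fixed set; it contains the complement of the cube. The generators are affine on the cells of one
finite arrangement of hyperplanes. A segment in general position from outside the cube to a moved
point meets the frontier of `U` at some `p`, and at most one hyperplane of the arrangement passes
through `p`. Hence near `p` there is one hyperplane `L = 0` such that the generators
are the identity on one side of it and affine on the other, where they have the form
`x ↦ x + L x • v` by continuity; since `p ∉ U`, some `v` is nonzero (`exists_shear_germs`). Germs of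
this form are closed under composition and inversion, and `v` satisfies a cocycle identity which
makes `log (1 + L v)`, or `v` itself if all these logarithms vanish, a nontrivial homomorphism to a
real vector space. The image is finitely generated and torsion-free, so the group surjects onto `ℤ`
(`exists_surjective_int_of_cocycle`).

Left-orderability follows by the Burns–Hale theorem (`IsLocallyIndicable.isLeftOrderable`).

That `PL(Iⁿ, ∂Iⁿ)` is a group is seen by describing piecewise linearity through hyperplane
arrangements instead of triangulations: for maps affine on the cells of a finite arrangement,
composition and inversion only require pulling functionals back along affine maps
(`IsCellwiseAffine.comp`, `IsCellwiseAffine.symm`). A simplex is a union of cells of a finite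
arrangement (`exists_cells_of_simplex`); conversely the cells in the cube, with one point chosen in
each, have a barycentric subdivision which triangulates the cube
(`exists_triangulation_of_cells`).
-/

/-! ### Left-orderability of locally indicable groups -/

/-- In a locally indicable group, the elements of a finite set without `1` can be replaced by
themselves or their inverses (according to membership in `P`) so that `1` is not a product of the
resulting elements. A surjection onto `ℤ` from the subgroup they generate decides the elements
outside its kernel, and the fewer remaining ones are handled by induction. -/
theorem IsLocallyIndicable.exists_one_notMem_closure {G : Type*} [Group G]
    (hG : IsLocallyIndicable G) (F : Finset G) (hF : (1 : G) ∉ F) :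
    ∃ P : Set G, (1 : G) ∉ Subsemigroup.closure
      {y | ∃ x ∈ F, (x ∈ P ∧ y = x) ∨ (x ∉ P ∧ y = x⁻¹)} := by
  classical
  induction F using Finset.strongInduction with
  | H F ih =>
  rcases F.eq_empty_or_nonempty with rfl | ⟨x₀, hx₀⟩
  · exact ⟨∅, by simp [Subsemigroup.notMem_bot]⟩
  have hFH : ∀ x ∈ F, x ∈ Subgroup.closure (F : Set G) := fun x hx => Subgroup.subset_closure hx
  set H := Subgroup.closure (F : Set G) with hH
  obtain ⟨φ, hφ⟩ := hG H ⟨F, rfl⟩ (by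
    intro h
    have := hFH x₀ hx₀
    rw [h, Subgroup.mem_bot] at this
    exact hF (this ▸ hx₀))
  let F₀ := F.filter fun x => ∃ hx : x ∈ H, φ ⟨x, hx⟩ = 1
  have hss : F₀ ⊂ F := by
    refine Finset.filter_ssubset.2 ?_
    by_contra! hcon
    have key : ∀ x (hx : x ∈ H), φ ⟨x, hx⟩ = 1 := by
      intro x hx
      induction hx using Subgroup.closure_induction with
      | mem x hx => exact (hcon x hx).2
      | one => exact map_one φ
      | mul x y hx hy h1 h2 =>
        have : (⟨x * y, mul_mem hx hy⟩ : H) = ⟨x, hx⟩ * ⟨y, hy⟩ := rfl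
        rw [this, map_mul, h1, h2, one_mul]
      | inv x hx h1 =>
        have : (⟨x⁻¹, inv_mem hx⟩ : H) = ⟨x, hx⟩⁻¹ := rfl
        rw [this, map_inv, h1, inv_one]
    obtain ⟨y, hy⟩ := hφ (Multiplicative.ofAdd 1)
    rw [key y.1 y.2] at hy
    exact absurd (congrArg Multiplicative.toAdd hy) (by simp)
  obtain ⟨P₀, hP₀⟩ := ih F₀ hss fun h => hF (Finset.mem_filter.1 h).1
  refine ⟨{x | (x ∈ F₀ ∧ x ∈ P₀) ∨ ∃ hx : x ∈ H, 0 < (φ ⟨x, hx⟩).toAdd}, fun h1 => ?_⟩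
  set T₀ := {y | ∃ x ∈ F₀, (x ∈ P₀ ∧ y = x) ∨ (x ∉ P₀ ∧ y = x⁻¹)} with hT₀
  have key : ∀ y ∈ Subsemigroup.closure {y | ∃ x ∈ F,
      (x ∈ {x | (x ∈ F₀ ∧ x ∈ P₀) ∨ ∃ hx : x ∈ H, 0 < (φ ⟨x, hx⟩).toAdd} ∧ y = x) ∨
      (x ∉ {x | (x ∈ F₀ ∧ x ∈ P₀) ∨ ∃ hx : x ∈ H, 0 < (φ ⟨x, hx⟩).toAdd} ∧ y = x⁻¹)},
      ∃ hy : y ∈ H, 0 < (φ ⟨y, hy⟩).toAdd ∨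
        ((φ ⟨y, hy⟩).toAdd = 0 ∧ y ∈ Subsemigroup.closure T₀) := by
    intro y hy
    induction hy using Subsemigroup.closure_induction with
    | mem y hy =>
      obtain ⟨x, hx, ⟨hxP, rfl⟩ | ⟨hxP, rfl⟩⟩ := hy
      · refine ⟨hFH _ hx, ?_⟩
        rcases hxP with ⟨h0, hp⟩ | ⟨hx', h⟩
        · obtain ⟨hx', hφx⟩ := (Finset.mem_filter.1 h0).2
          exact Or.inr ⟨by rw [hφx]; rfl, Subsemigroup.subset_closure ⟨_, h0, Or.inl ⟨hp, rfl⟩⟩⟩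
        · exact Or.inl h
      · have hxH := hFH _ hx
        refine ⟨inv_mem hxH, ?_⟩
        have e : (⟨x⁻¹, inv_mem hxH⟩ : H) = ⟨x, hxH⟩⁻¹ := rfl
        rw [e, map_inv, toAdd_inv]
        simp only [Set.mem_ofPred_eq, not_or, not_and, not_exists, not_lt] at hxP
        rcases (hxP.2 hxH).lt_or_eq with h | h
        · left; linarith
        · right
          have h0 : x ∈ F₀ := Finset.mem_filter.2 ⟨hx, hxH, Multiplicative.toAdd.injective h⟩
          exact ⟨by rw [h]; rfl, Subsemigroup.subset_closure ⟨x, h0, Or.inr ⟨hxP.1 h0, rfl⟩⟩⟩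
    | mul x y _ _ h1 h2 =>
      obtain ⟨hx, h1⟩ := h1
      obtain ⟨hy, h2⟩ := h2
      refine ⟨mul_mem hx hy, ?_⟩
      have e : (⟨x * y, mul_mem hx hy⟩ : H) = ⟨x, hx⟩ * ⟨y, hy⟩ := rfl
      rw [e, map_mul, toAdd_mul]
      rcases h1 with h1 | ⟨h1, h1'⟩ <;> rcases h2 with h2 | ⟨h2, h2'⟩
      · left; linarith
      · left; linarith
      · left; linarith
      · exact Or.inr ⟨by linarith, mul_mem h1' h2'⟩
  obtain ⟨h, hlt | ⟨-, hmem⟩⟩ := key 1 h1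
  · have e : (⟨1, h⟩ : H) = 1 := rfl
    rw [e, map_one, toAdd_one] at hlt
    exact lt_irrefl _ hlt
  · exact hP₀ hmem

/-- The Burns–Hale theorem for locally indicable groups. The sign choices made for the finite
subsets are glued along an ultrafilter to a positive cone. -/
theorem IsLocallyIndicable.isLeftOrderable {G : Type*} [Group G] (hG : IsLocallyIndicable G) :
    IsLeftOrderable G := by
  classical
  choose P hP using fun F : Finset G =>
    hG.exists_one_notMem_closure (F.erase 1) (Finset.notMem_erase 1 F)
  let U : Ultrafilter (Finset G) := Ultrafilter.of Filter.atTop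
  have hU : ∀ g : G, ∀ᶠ F in (U : Filter (Finset G)), g ∈ F := fun g =>
    Ultrafilter.of_le Filter.atTop ((Filter.eventually_ge_atTop {g}).mono fun F hF => hF (by simp))
  let T : Finset G → Set G := fun F =>
    {y | ∃ x ∈ F.erase 1, (x ∈ P F ∧ y = x) ∨ (x ∉ P F ∧ y = x⁻¹)}
  let Q : G → Prop := fun g => g ≠ 1 ∧ ∀ᶠ F in (U : Filter (Finset G)), g ∈ P F
  have hQT : ∀ g, Q g → ∀ᶠ F in (U : Filter (Finset G)), g ∈ Subsemigroup.closure (T F) := by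
    intro g hg
    filter_upwards [hg.2, hU g] with F h1 h2
    exact Subsemigroup.subset_closure ⟨g, Finset.mem_erase.2 ⟨hg.1, h2⟩, Or.inl ⟨h1, rfl⟩⟩
  have hQT' : ∀ g, g ≠ 1 → ¬ Q g →
      ∀ᶠ F in (U : Filter (Finset G)), g⁻¹ ∈ Subsemigroup.closure (T F) := by
    intro g hg1 hg
    have : ∀ᶠ F in (U : Filter (Finset G)), g ∉ P F :=
      Ultrafilter.eventually_not.2 fun h => hg ⟨hg1, h⟩
    filter_upwards [this, hU g] with F h1 h2
    exact Subsemigroup.subset_closure ⟨g, Finset.mem_erase.2 ⟨hg1, h2⟩, Or.inr ⟨h1, rfl⟩⟩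
  have hmul : ∀ g h, Q g → Q h → Q (g * h) := by
    intro g h hg hh
    by_contra hgh
    by_cases h1 : g * h = 1
    · obtain ⟨F, h2, h3⟩ := ((hQT g hg).and (hQT h hh)).exists
      have h4 := mul_mem h2 h3
      rw [h1] at h4
      exact hP F h4
    · obtain ⟨F, ⟨h2, h3⟩, h4⟩ := (((hQT g hg).and (hQT h hh)).and (hQT' _ h1 hgh)).exists
      have h5 := mul_mem h4 (mul_mem h2 h3)
      rw [inv_mul_cancel] at h5
      exact hP F h5
  have hinv : ∀ g, g ≠ 1 → Q g ∨ Q g⁻¹ := by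
    intro g hg
    by_contra! hcon
    obtain ⟨F, h2, h3⟩ := ((hQT' g hg hcon.1).and (hQT' _ (inv_ne_one.2 hg) hcon.2)).exists
    have h4 := mul_mem h2 h3
    rw [mul_inv_cancel] at h4
    exact hP F h4
  have h1 : ¬ Q 1 := fun h => h.1 rfl
  refine ⟨fun f g => Q (f⁻¹ * g), ?_, fun f g h hgh => by simpa [mul_assoc] using hgh⟩
  refine
    { irrefl := fun a h => h1 (by simpa using h)
      trans := fun a b c hab hbc => by simpa [mul_assoc] using hmul _ _ hab hbc
      trichotomous := fun a b hab hba => ?_ }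
  by_contra hne
  rcases hinv (a⁻¹ * b) (fun h => hne (inv_mul_eq_one.1 h)) with h | h
  · exact hab h
  · exact hba (by simpa using h)

/-! ### Surjections onto the integers -/

/-- A finitely generated group with a nontrivial homomorphism to a real vector space surjects
onto `ℤ`: the image is a nonzero finitely generated free abelian group. -/
theorem exists_surjective_int_of_hom_to_module {H V : Type*} [Group H] [Group.FG H]
    [AddCommGroup V] [Module ℝ V] (φ : H →* Multiplicative V) (hφ : ∃ h, φ h ≠ 1) :
    ∃ ψ : H →* Multiplicative ℤ, Function.Surjective ψ := by
  let φ' : Additive H →+ V := MonoidHom.toAdditiveLeft φ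
  let f : Additive H →+ φ'.range := φ'.rangeRestrict
  have hf : Function.Surjective f := φ'.rangeRestrict_surjective
  have hfg : AddGroup.FG φ'.range := AddGroup.fg_of_surjective hf
  have : Module.Finite ℤ φ'.range := Module.Finite.iff_addGroup_fg.2 hfg
  have : Module.IsTorsionFree ℤ V := Module.IsTorsionFree.trans ℝ
  have : IsAddTorsionFree V := Module.isTorsionFree_int_iff_isAddTorsionFree.1 this
  let b := Module.Free.chooseBasis ℤ φ'.range
  have hnt : Nontrivial φ'.range := by
    obtain ⟨h, hh⟩ := hφ
    exact ⟨f (Additive.ofMul h), 0, fun h0 => hh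
      (Multiplicative.toAdd.injective (congrArg Subtype.val h0))⟩
  obtain ⟨i⟩ := b.index_nonempty
  refine ⟨AddMonoidHom.toMultiplicativeRight ((b.coord i).toAddMonoidHom.comp f), fun z => ?_⟩
  obtain ⟨h, hh⟩ := hf (z.toAdd • b i)
  refine ⟨h.toMul, Multiplicative.toAdd.injective ?_⟩
  change b.coord i (f h) = z.toAdd
  simp [hh]

/-- The linear parts `1 + L (v h)` and the translation parts `v h` of a group of affine maps
`x ↦ x + L x • v h` of a half-space provide a surjection onto `ℤ` when not all of them are trivial:
either the logarithm of the linear part is a nontrivial homomorphism, or `v` is one. -/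
theorem exists_surjective_int_of_cocycle {H V : Type*} [Group H] [Group.FG H]
    [AddCommGroup V] [Module ℝ V] (L : V →ₗ[ℝ] ℝ) (v : H → V)
    (hpos : ∀ h, 0 < 1 + L (v h)) (hmul : ∀ h g, v (h * g) = v g + (1 + L (v g)) • v h)
    (hne : ∃ h, v h ≠ 0) :
    ∃ ψ : H →* Multiplicative ℤ, Function.Surjective ψ := by
  by_cases hL : ∀ h, L (v h) = 0
  · refine exists_surjective_int_of_hom_to_module
      (MonoidHom.mk' (fun h => Multiplicative.ofAdd (v h)) fun a b => ?_) ?_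
    · rw [hmul, hL, add_zero, one_smul, add_comm, ofAdd_add]
    · obtain ⟨h, hh⟩ := hne
      exact ⟨h, fun h' => hh (Multiplicative.ofAdd.injective h')⟩
  · push Not at hL
    refine exists_surjective_int_of_hom_to_module (V := ℝ)
      (MonoidHom.mk' (fun h => Multiplicative.ofAdd (Real.log (1 + L (v h)))) fun a b => ?_) ?_
    · rw [← ofAdd_add, ← Real.log_mul (hpos a).ne' (hpos b).ne', hmul]
      congr 2
      simp only [map_add, map_smul, smul_eq_mul]
      ring
    · obtain ⟨h, hh⟩ := hL
      refine ⟨h, fun h' => hh ?_⟩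
      have h0 : Real.log (1 + L (v h)) = 0 := Multiplicative.ofAdd.injective h'
      have := Real.eq_one_of_pos_of_log_eq_zero (hpos h) h0
      linarith

/-! ### Piecewise affine maps and finite families of affine functionals -/

/-- The sign vector of a point with respect to a family of affine functionals. The fibres of
`signVec ℓ` are the (relatively open) cells of the arrangement of the hyperplanes `ℓ i = 0`. -/
noncomputable def signVec {ι E : Type*} [AddCommGroup E] [Module ℝ E] (ℓ : ι → E →ᵃ[ℝ] ℝ)
    (x : E) : ι → SignType :=
  fun i => SignType.sign (ℓ i x)

/-- The map `F` agrees with an affine map on each cell of the arrangement defined by `ℓ`. -/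
def AffineOnCells {ι E : Type*} [AddCommGroup E] [Module ℝ E] (ℓ : ι → E →ᵃ[ℝ] ℝ)
    (F : E → E) : Prop :=
  ∀ c : ι → SignType, ∃ A : E →ᵃ[ℝ] E, ∀ x, signVec ℓ x = c → F x = A x

/-- The map `F` agrees with an affine map on each cell of some finite arrangement of hyperplanes.
Since no continuity is asked for, this alone does not make `F` piecewise linear. -/
def IsCellwiseAffine {E : Type*} [AddCommGroup E] [Module ℝ E] (F : E → E) : Prop :=
  ∃ (ι : Type) (_ : Finite ι) (ℓ : ι → E →ᵃ[ℝ] ℝ), AffineOnCells ℓ F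

section Cellwise

variable {ι κ E : Type*} [AddCommGroup E] [Module ℝ E]

theorem signVec_eq_iff {ℓ : ι → E →ᵃ[ℝ] ℝ} {x y : E} :
    signVec ℓ x = signVec ℓ y ↔ ∀ i, SignType.sign (ℓ i x) = SignType.sign (ℓ i y) :=
  funext_iff

theorem affineOnCells_iff {ℓ : ι → E →ᵃ[ℝ] ℝ} {F : E → E} :
    AffineOnCells ℓ F ↔ ∀ x₀, ∃ A : E →ᵃ[ℝ] E, ∀ x, signVec ℓ x = signVec ℓ x₀ → F x = A x := by
  refine ⟨fun h x₀ => h _, fun h c => ?_⟩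
  by_cases hc : ∃ x₀, signVec ℓ x₀ = c
  · obtain ⟨x₀, rfl⟩ := hc
    exact h x₀
  · exact ⟨AffineMap.id ℝ E, fun x hx => absurd ⟨x, hx⟩ hc⟩

theorem AffineOnCells.refine {ℓ : ι → E →ᵃ[ℝ] ℝ} {m : κ → E →ᵃ[ℝ] ℝ} {F : E → E}
    (h : AffineOnCells ℓ F)
    (hm : ∀ x y, signVec m x = signVec m y → signVec ℓ x = signVec ℓ y) :
    AffineOnCells m F :=
  affineOnCells_iff.2 fun x₀ =>
    let ⟨A, hA⟩ := affineOnCells_iff.1 h x₀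
    ⟨A, fun x hx => hA x (hm _ _ hx)⟩

theorem isCellwiseAffine_id : IsCellwiseAffine (id : E → E) :=
  ⟨Empty, inferInstance, Empty.elim, fun _ => ⟨AffineMap.id ℝ E, fun _ _ => rfl⟩⟩

theorem IsCellwiseAffine.comp {F G : E → E} (hG : IsCellwiseAffine G) (hF : IsCellwiseAffine F) :
    IsCellwiseAffine (G ∘ F) := by
  obtain ⟨ι, _, ℓ, hF⟩ := hF
  obtain ⟨κ, _, m, hG⟩ := hG
  choose A hA using hF
  -- The functionals of `G` are pulled back along every affine piece of `F`.
  refine ⟨ι ⊕ (ι → SignType) × κ, inferInstance,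
    Sum.elim ℓ fun p => (m p.2).comp (A p.1), affineOnCells_iff.2 fun x₀ => ?_⟩
  obtain ⟨B, hB⟩ := affineOnCells_iff.1 hG (F x₀)
  refine ⟨B.comp (A (signVec ℓ x₀)), fun x hx => ?_⟩
  rw [signVec_eq_iff] at hx
  have h1 : signVec ℓ x = signVec ℓ x₀ := signVec_eq_iff.2 fun i => hx (Sum.inl i)
  have h2 := hA _ x h1
  have h3 := hA _ x₀ rfl
  rw [Function.comp_apply, hB (F x), h2]
  · rfl
  · refine signVec_eq_iff.2 fun k => ?_
    rw [h2, h3]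
    exact hx (Sum.inr (signVec ℓ x₀, k))

theorem exists_common_cells {J : Type} [Finite J] {F : J → E → E}
    (hF : ∀ j, IsCellwiseAffine (F j)) :
    ∃ (ι : Type) (_ : Finite ι) (ℓ : ι → E →ᵃ[ℝ] ℝ), ∀ j, AffineOnCells ℓ (F j) := by
  choose ι hι ℓ h using hF
  exact ⟨Σ j, ι j, inferInstance, fun p => ℓ p.1 p.2, fun j => (h j).refine fun x y hxy =>
    signVec_eq_iff.2 fun i => signVec_eq_iff.1 hxy ⟨j, i⟩⟩

open Filter Topology in
theorem eventually_sign_eq {α : Type*} {l : Filter α} {f : α → ℝ} {r : ℝ} (hr : r ≠ 0)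
    (hf : Tendsto f l (𝓝 r)) : ∀ᶠ a in l, SignType.sign (f a) = SignType.sign r := by
  have h := ((continuousAt_sign_of_ne_zero hr).tendsto.comp hf)
  rw [nhds_discrete, tendsto_pure] at h
  exact h

open Filter Topology in
/-- An affine map that is injective on a cell has an affine left inverse there: the cell is
relatively open in its affine span, so that the linear part is injective on the direction. -/
theorem exists_affine_leftInverse_on_cell [Finite ι] (ℓ : ι → E →ᵃ[ℝ] ℝ) (x₀ : E)
    (A : E →ᵃ[ℝ] E) (hA : Set.InjOn A {x | signVec ℓ x = signVec ℓ x₀}) :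
    ∃ B : E →ᵃ[ℝ] E, ∀ x, signVec ℓ x = signVec ℓ x₀ → B (A x) = x := by
  let V : Submodule ℝ E := ⨅ i : {i // ℓ i x₀ = 0}, LinearMap.ker (ℓ i).linear
  have hV : ∀ v, v ∈ V ↔ ∀ i, ℓ i x₀ = 0 → (ℓ i).linear v = 0 := by
    intro v
    simp [V, Submodule.mem_iInf]
  have hinj : LinearMap.ker (A.linear.comp V.subtype) = ⊥ := by
    refine LinearMap.ker_eq_bot'.2 fun v hv => ?_
    have hev : ∀ᶠ ε in 𝓝[≠] (0 : ℝ), signVec ℓ (ε • (v : E) + x₀) = signVec ℓ x₀ := by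
      simp only [signVec_eq_iff, eventually_all]
      intro i
      have e : ∀ ε : ℝ, ℓ i (ε • (v : E) + x₀) = ε * (ℓ i).linear v + ℓ i x₀ := by
        intro ε
        rw [← vadd_eq_add, AffineMap.map_vadd, map_smul, vadd_eq_add, smul_eq_mul]
      simp only [e]
      by_cases h0 : ℓ i x₀ = 0
      · simp [(hV _).1 v.2 i h0, h0]
      · refine eventually_sign_eq h0 ?_
        refine Tendsto.mono_left ?_ nhdsWithin_le_nhds
        have : Continuous fun ε : ℝ => ε * (ℓ i).linear v + ℓ i x₀ := by fun_prop
        simpa using this.tendsto 0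
    obtain ⟨ε, hε, hε0⟩ := (hev.and self_mem_nhdsWithin).exists
    have hv' : A.linear (v : E) = 0 := hv
    have h1 : A (ε • (v : E) + x₀) = A x₀ := by
      rw [← vadd_eq_add, AffineMap.map_vadd, map_smul, hv', smul_zero, zero_vadd]
    have h2 := hA hε rfl h1
    have h3 : ε • (v : E) = 0 := by simpa using h2
    exact Subtype.ext ((smul_eq_zero.1 h3).resolve_left hε0)
  obtain ⟨g, hg⟩ := LinearMap.exists_leftInverse_of_injective _ hinj
  refine ⟨((V.subtype.comp g).toAffineMap.comp
    (AffineMap.id ℝ E - AffineMap.const ℝ E (A x₀))) + AffineMap.const ℝ E x₀, fun x hx => ?_⟩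
  have hxV : x - x₀ ∈ V := by
    refine (hV _).2 fun i hi => ?_
    have h1 : SignType.sign (ℓ i x) = SignType.sign (ℓ i x₀) := signVec_eq_iff.1 hx i
    rw [hi, sign_zero, sign_eq_zero_iff] at h1
    rw [← vsub_eq_sub, AffineMap.linearMap_vsub, hi, h1, vsub_self]
  have h2 : A x - A x₀ = A.linear (x - x₀) := by
    rw [← vsub_eq_sub x, AffineMap.linearMap_vsub, vsub_eq_sub]
  have h3 : g (A.linear (x - x₀)) = ⟨x - x₀, hxV⟩ := LinearMap.congr_fun hg ⟨x - x₀, hxV⟩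
  change ((g (A x - A x₀) : V) : E) + x₀ = x
  rw [h2, h3, sub_add_cancel]

/-- On a cell of the arrangement formed by the conditions describing the images of the cells of
`e`, the inverse of `e` is the left inverse of one affine piece of `e`. -/
theorem IsCellwiseAffine.symm [FiniteDimensional ℝ E] {e : E ≃ E} (he : IsCellwiseAffine e) :
    IsCellwiseAffine e.symm := by
  obtain ⟨ι, _, ℓ, h⟩ := he
  choose A hA using h
  have hB : ∀ c : ι → SignType, ∃ B : E →ᵃ[ℝ] E, ∀ x, signVec ℓ x = c → B (e x) = x := by
    intro c
    by_cases hc : ∃ x₀, signVec ℓ x₀ = c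
    · obtain ⟨x₀, rfl⟩ := hc
      obtain ⟨B, hB⟩ := exists_affine_leftInverse_on_cell ℓ x₀ (A (signVec ℓ x₀))
        fun x hx y hy hxy => e.injective (by rw [hA _ x hx, hA _ y hy, hxy])
      exact ⟨B, fun x hx => by rw [hA _ x hx, hB x hx]⟩
    · exact ⟨AffineMap.id ℝ E, fun x hx => absurd ⟨x, hx⟩ hc⟩
  choose B hB using hB
  let b := Module.finBasis ℝ E
  refine ⟨(ι → SignType) × (ι ⊕ Fin (Module.finrank ℝ E)), inferInstance,
    fun p => Sum.elim (fun i => (ℓ i).comp (B p.1))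
      (fun j => (b.coord j).toAffineMap.comp ((A p.1).comp (B p.1) - AffineMap.id ℝ E)) p.2,
    affineOnCells_iff.2 fun y₀ => ?_⟩
  set c := signVec ℓ (e.symm y₀) with hc
  have hy₀ : B c y₀ = e.symm y₀ := by simpa using hB c (e.symm y₀) rfl
  refine ⟨B c, fun y hy => ?_⟩
  rw [signVec_eq_iff] at hy
  have h1 : signVec ℓ (B c y) = c := by
    have : signVec ℓ (B c y) = signVec ℓ (B c y₀) :=
      signVec_eq_iff.2 fun i => hy (c, Sum.inl i)
    rw [this, hy₀]
  have h2 : A c (B c y) = y := by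
    refine b.ext_elem fun j => ?_
    have h3 := hy (c, Sum.inr j)
    have h4 : A c (B c y₀) = y₀ := by rw [hy₀, ← hA c _ rfl, e.apply_symm_apply]
    simpa [h4, sub_eq_zero] using h3
  rw [Equiv.symm_apply_eq, hA c _ h1, h2]

end Cellwise

/-! ### Triangulating a bounded union of cells -/

/-- The cell of `x` is a face of the cell of `y`: every closed half-space `ℓ i ≥ 0` or `ℓ i ≤ 0`
containing `y` contains `x`. -/
def FaceLE {ι E : Type*} [AddCommGroup E] [Module ℝ E] (ℓ : ι → E →ᵃ[ℝ] ℝ) (x y : E) : Prop :=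
  ∀ i, (0 ≤ ℓ i y → 0 ≤ ℓ i x) ∧ (ℓ i y ≤ 0 → ℓ i x ≤ 0)

/-- A finite set of points of `C` whose cells form a chain for the face relation. When `C` has one
point in each cell, flags are the simplices of the barycentric subdivision of the cells. -/
def IsFlag {ι E : Type*} [AddCommGroup E] [Module ℝ E] (ℓ : ι → E →ᵃ[ℝ] ℝ) (C : Set E)
    (s : Finset E) : Prop :=
  (∀ x ∈ s, x ∈ C) ∧ ∀ x ∈ s, ∀ y ∈ s, FaceLE ℓ x y ∨ FaceLE ℓ y x

section Triangulation

variable {ι E : Type*} [AddCommGroup E] [Module ℝ E] {ℓ : ι → E →ᵃ[ℝ] ℝ} {C : Set E}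

theorem FaceLE.refl (x : E) : FaceLE ℓ x x := fun _ => ⟨id, id⟩

theorem FaceLE.trans {x y z : E} (h : FaceLE ℓ x y) (h' : FaceLE ℓ y z) : FaceLE ℓ x z :=
  fun i => ⟨fun hz => (h i).1 ((h' i).1 hz), fun hz => (h i).2 ((h' i).2 hz)⟩

theorem FaceLE.antisymm {x y : E} (h : FaceLE ℓ x y) (h' : FaceLE ℓ y x) :
    signVec ℓ x = signVec ℓ y := by
  refine signVec_eq_iff.2 fun i => ?_
  rcases lt_trichotomy (ℓ i y) 0 with hy | hy | hy
  · have hx : ℓ i x < 0 := by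
      by_contra! hx
      exact absurd ((h' i).1 hx) (not_le.2 hy)
    rw [sign_neg hx, sign_neg hy]
  · rw [le_antisymm ((h i).2 hy.le) ((h i).1 hy.ge), hy]
  · have hx : 0 < ℓ i x := by
      by_contra! hx
      exact absurd ((h' i).2 hx) (not_le.2 hy)
    rw [sign_pos hx, sign_pos hy]

theorem FaceLE.of_signVec_eq {x y : E} (h : signVec ℓ x = signVec ℓ y) : FaceLE ℓ x y := by
  intro i
  have hi := signVec_eq_iff.1 h i
  constructor <;> intro hy
  · rwa [← sign_nonneg_iff, hi, sign_nonneg_iff]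
  · rwa [← sign_nonpos_iff, hi, sign_nonpos_iff]

theorem convex_setOf_faceLE (m : E) : Convex ℝ {x | FaceLE ℓ x m} := by
  intro x hx y hy a b ha hb hab i
  rw [Convex.combo_affine_apply hab, smul_eq_mul, smul_eq_mul]
  constructor <;> intro h
  · exact add_nonneg (mul_nonneg ha ((hx i).1 h)) (mul_nonneg hb ((hy i).1 h))
  · exact add_nonpos (mul_nonpos_of_nonneg_of_nonpos ha ((hx i).2 h))
      (mul_nonpos_of_nonneg_of_nonpos hb ((hy i).2 h))

/-- A half-open segment from a cell towards a point of its closure stays in the cell. -/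
theorem signVec_combo {m y : E} (h : FaceLE ℓ y m) {a b : ℝ} (ha : 0 < a) (hb : 0 ≤ b)
    (hab : a + b = 1) : signVec ℓ (a • m + b • y) = signVec ℓ m := by
  refine signVec_eq_iff.2 fun i => ?_
  rw [Convex.combo_affine_apply hab, smul_eq_mul, smul_eq_mul]
  rcases lt_trichotomy (ℓ i m) 0 with hm | hm | hm
  · rw [sign_neg hm, sign_neg]
    exact add_neg_of_neg_of_nonpos (mul_neg_of_pos_of_neg ha hm)
      (mul_nonpos_of_nonneg_of_nonpos hb ((h i).2 hm.le))
  · rw [hm, le_antisymm ((h i).2 hm.le) ((h i).1 hm.ge), mul_zero, mul_zero, add_zero]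
  · rw [sign_pos hm, sign_pos]
    exact add_pos_of_pos_of_nonneg (mul_pos ha hm) (mul_nonneg hb ((h i).1 hm.le))

theorem faceLE_of_mem_convexHull {s : Finset E} {m x : E} (hm : ∀ y ∈ s, FaceLE ℓ y m)
    (hx : x ∈ convexHull ℝ (s : Set E)) : FaceLE ℓ x m :=
  convexHull_min (fun y hy => hm y hy) (convex_setOf_faceLE m) hx

theorem IsFlag.mono {s t : Finset E} (hs : IsFlag ℓ C s) (hts : t ⊆ s) : IsFlag ℓ C t :=
  ⟨fun x hx => hs.1 x (hts hx), fun x hx y hy => hs.2 x (hts hx) y (hts hy)⟩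

theorem IsFlag.exists_top {s : Finset E} (hs : IsFlag ℓ C s) (hne : s.Nonempty) :
    ∃ m ∈ s, ∀ x ∈ s, FaceLE ℓ x m := by
  classical
  induction hne using Finset.Nonempty.cons_induction with
  | singleton a =>
    exact ⟨a, by simp, by simpa using FaceLE.refl a⟩
  | cons a s ha hne ih =>
    obtain ⟨m, hm, hmax⟩ := ih (hs.mono fun x hx => Finset.mem_cons.2 (Or.inr hx))
    rcases hs.2 a (by simp) m (by simp [hm]) with h | h
    · refine ⟨m, by simp [hm], fun x hx => ?_⟩
      rcases Finset.mem_cons.1 hx with rfl | hx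
      · exact h
      · exact hmax x hx
    · refine ⟨a, by simp, fun x hx => ?_⟩
      rcases Finset.mem_cons.1 hx with rfl | hx
      · exact FaceLE.refl _
      · exact (hmax x hx).trans h

theorem exists_combo_of_mem_convexHull [DecidableEq E] {s : Finset E} {m x : E} (hm : m ∈ s)
    (hmax : ∀ y ∈ s, FaceLE ℓ y m) (hx : x ∈ convexHull ℝ (s : Set E)) :
    ∃ y : E, ∃ a b : ℝ, 0 ≤ a ∧ 0 ≤ b ∧ a + b = 1 ∧ x = a • m + b • y ∧ FaceLE ℓ y m ∧
      (b = 0 ∨ y ∈ convexHull ℝ (s.erase m : Set E)) := by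
  rcases (s.erase m).eq_empty_or_nonempty with he | hne
  · have hs : s = {m} := by
      rw [← Finset.insert_erase hm, he]
      rfl
    rw [hs, Finset.coe_singleton, convexHull_singleton] at hx
    exact ⟨m, 1, 0, zero_le_one, le_rfl, add_zero 1, by simpa using hx, FaceLE.refl m, Or.inl rfl⟩
  · rw [← Finset.insert_erase hm, Finset.coe_insert,
      convexHull_insert (Finset.coe_nonempty.2 hne), mem_convexJoin] at hx
    obtain ⟨m', rfl, y, hy, a, b, ha, hb, hab, rfl⟩ := hx
    exact ⟨y, a, b, ha, hb, hab, rfl, faceLE_of_mem_convexHull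
      (fun z hz => hmax z (Finset.mem_of_mem_erase hz)) hy, Or.inr hy⟩

theorem IsFlag.not_faceLE_of_mem_convexHull_erase [DecidableEq E] (hC : Set.InjOn (signVec ℓ) C)
    {s : Finset E} (hs : IsFlag ℓ C s) {m y : E} (hm : m ∈ s) (hmax : ∀ y ∈ s, FaceLE ℓ y m)
    (hy : y ∈ convexHull ℝ (s.erase m : Set E)) : ¬ FaceLE ℓ m y := by
  intro h
  obtain ⟨m₂, hm₂, hmax₂⟩ := (hs.mono (Finset.erase_subset m s)).exists_top
    (Finset.coe_nonempty.1 (convexHull_nonempty_iff.1 ⟨y, hy⟩))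
  have hms := Finset.mem_of_mem_erase hm₂
  exact Finset.ne_of_mem_erase hm₂ (hC (hs.1 _ hms) (hs.1 _ hm)
    ((hmax m₂ hms).antisymm (h.trans (faceLE_of_mem_convexHull hmax₂ hy))))

/-- The weight of the top vertex in a convex combination of a flag is determined by the point:
otherwise a combination of the other vertices would lie in the top cell. -/
theorem IsFlag.weight_le [DecidableEq E] (hC : Set.InjOn (signVec ℓ) C)
    {s : Finset E} (hs : IsFlag ℓ C s) {m y y' : E} (hm : m ∈ s) (hmax : ∀ y ∈ s, FaceLE ℓ y m)
    {a b a' b' : ℝ} (hb' : 0 ≤ b') (hab : a + b = 1) (hab' : a' + b' = 1)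
    (hy : b = 0 ∨ y ∈ convexHull ℝ (s.erase m : Set E)) (hy' : FaceLE ℓ y' m)
    (h : a • m + b • y = a' • m + b' • y') : a' ≤ a := by
  by_contra! hlt
  have hb : 0 < b := by linarith
  have h1 : y = ((a' - a) / b) • m + (b' / b) • y' := by
    have h2 : b • y = (a' - a) • m + b' • y' := by
      rw [sub_smul, sub_add_eq_add_sub, ← h, add_sub_cancel_left]
    rw [div_eq_inv_mul, div_eq_inv_mul, mul_smul, mul_smul, ← smul_add, ← h2,
      inv_smul_smul₀ hb.ne']
  refine hs.not_faceLE_of_mem_convexHull_erase hC hm hmax (hy.resolve_left hb.ne')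
    (FaceLE.of_signVec_eq ?_)
  rw [h1]
  refine (signVec_combo hy' (div_pos (by linarith) hb) (by positivity) ?_).symm
  field_simp
  linarith

theorem IsFlag.mem_convexHull_inter (hC : Set.InjOn (signVec ℓ) C) {s t : Finset E}
    (hs : IsFlag ℓ C s) (ht : IsFlag ℓ C t) {x : E} (hxs : x ∈ convexHull ℝ (s : Set E))
    (hxt : x ∈ convexHull ℝ (t : Set E)) : x ∈ convexHull ℝ (s ∩ t : Set E) := by
  classical
  induction hN : s.card + t.card using Nat.strong_induction_on generalizing s t x with
  | _ N ih =>
  subst hN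
  obtain ⟨m, hm, hmax⟩ := hs.exists_top (Finset.coe_nonempty.1 (convexHull_nonempty_iff.1 ⟨x, hxs⟩))
  obtain ⟨m', hm', hmax'⟩ :=
    ht.exists_top (Finset.coe_nonempty.1 (convexHull_nonempty_iff.1 ⟨x, hxt⟩))
  obtain ⟨y, a, b, ha, hb, hab, hx, hym, hy⟩ := exists_combo_of_mem_convexHull hm hmax hxs
  obtain ⟨y', a', b', ha', hb', hab', hx', hym', hy'⟩ :=
    exists_combo_of_mem_convexHull hm' hmax' hxt
  have hse := Finset.card_erase_lt_of_mem hm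
  have hte := Finset.card_erase_lt_of_mem hm'
  have hs' := hs.mono (Finset.erase_subset m s)
  have ht' := ht.mono (Finset.erase_subset m' t)
  have hsub : ((s.erase m : Finset E) : Set E) ⊆ s := Finset.coe_subset.2 (Finset.erase_subset m s)
  have hsub' : ((t.erase m' : Finset E) : Set E) ⊆ t :=
    Finset.coe_subset.2 (Finset.erase_subset m' t)
  rcases ha.eq_or_lt with rfl | ha
  · obtain rfl : b = 1 := by linarith
    have hxy : x = y := by simpa using hx
    exact convexHull_mono (Set.inter_subset_inter_left _ hsub)
      (ih _ (by omega) hs' ht (hxy ▸ hy.resolve_left one_ne_zero) hxt rfl)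
  rcases ha'.eq_or_lt with rfl | ha'
  · obtain rfl : b' = 1 := by linarith
    have hxy : x = y' := by simpa using hx'
    exact convexHull_mono (Set.inter_subset_inter_right _ hsub')
      (ih _ (by omega) hs ht' hxs (hxy ▸ hy'.resolve_left one_ne_zero) rfl)
  obtain rfl : m = m' := hC (hs.1 _ hm) (ht.1 _ hm') (by
    rw [← signVec_combo hym ha hb hab, ← signVec_combo hym' ha' hb' hab', ← hx, ← hx'])
  have haa : a = a' := le_antisymm
    (ht.weight_le hC hm' hmax' hb hab' hab hy' hym (by rw [← hx, ← hx']))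
    (hs.weight_le hC hm hmax hb' hab hab' hy hym' (by rw [← hx, ← hx']))
  obtain rfl : b = b' := by linarith
  subst haa
  have hmst : m ∈ convexHull ℝ (s ∩ t : Set E) := subset_convexHull ℝ _ ⟨hm, hm'⟩
  rcases eq_or_ne b 0 with rfl | hb0
  · obtain rfl : a = 1 := by linarith
    have : x = m := by simpa using hx
    rwa [this]
  · have hyy : y = y' := by
      have := hx.symm.trans hx'
      exact smul_right_injective E hb0 (add_left_cancel this)
    subst hyy
    have := ih _ (by omega) hs' ht' (hy.resolve_left hb0) (hy'.resolve_left hb0) rfl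
    rw [hx]
    exact convex_convexHull ℝ _ hmst (convexHull_mono (Set.inter_subset_inter hsub hsub') this)
      ha.le hb hab

theorem IsFlag.affineIndependent (hC : Set.InjOn (signVec ℓ) C) {s : Finset E}
    (hs : IsFlag ℓ C s) : AffineIndependent ℝ ((↑) : s → E) := by
  classical
  induction s using Finset.strongInduction with
  | H s ih =>
  rcases s.eq_empty_or_nonempty with rfl | hne
  · exact affineIndependent_of_subsingleton ℝ _
  obtain ⟨m, hm, hmax⟩ := hs.exists_top hne
  refine AffineIndependent.affineIndependent_of_notMem_span (i := ⟨m, hm⟩) ?_ ?_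
  · refine (ih _ (Finset.erase_ssubset hm) (hs.mono (Finset.erase_subset m s))).comp_embedding
      ⟨fun x : {y : s // y ≠ ⟨m, hm⟩} => (⟨x.1.1, Finset.mem_erase.2
        ⟨fun h => x.2 (Subtype.ext h), x.1.2⟩⟩ : s.erase m), fun x y hxy => ?_⟩
    exact Subtype.ext (Subtype.ext (congrArg (fun z : s.erase m => (z : E)) hxy))
  · intro hspan
    rcases (s.erase m).eq_empty_or_nonempty with he | hne'
    · have : ((↑) : s → E) '' {x | x ≠ ⟨m, hm⟩} = ∅ := by
        refine Set.eq_empty_of_forall_notMem ?_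
        rintro _ ⟨x, hx, rfl⟩
        have : (x : E) ∈ s.erase m := Finset.mem_erase.2 ⟨fun h => hx (Subtype.ext h), x.2⟩
        simp [he] at this
      rw [this, AffineSubspace.span_empty] at hspan
      exact hspan
    · obtain ⟨m₂, hm₂, hmax₂⟩ := (hs.mono (Finset.erase_subset m s)).exists_top hne'
      have hnot := hs.not_faceLE_of_mem_convexHull_erase hC hm hmax (subset_convexHull ℝ _ hm₂)
      -- Some functional vanishes on all vertices except the top one.
      obtain ⟨i, hi₂, hi⟩ : ∃ i, ℓ i m₂ = 0 ∧ ℓ i m ≠ 0 := by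
        by_contra! hcon
        have h21 := hmax m₂ (Finset.mem_of_mem_erase hm₂)
        refine hnot fun i => ⟨fun h => ?_, fun h => ?_⟩
        · by_contra! hlt
          exact hlt.ne (hcon i (le_antisymm ((h21 i).2 hlt.le) h))
        · by_contra! hlt
          exact hlt.ne' (hcon i (le_antisymm h ((h21 i).1 hlt.le)))
      have hle : affineSpan ℝ (((↑) : s → E) '' {x | x ≠ ⟨m, hm⟩}) ≤
          (affineSpan ℝ {(0 : ℝ)}).comap (ℓ i) := by
        refine affineSpan_le.2 ?_
        rintro _ ⟨x, hx, rfl⟩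
        have hxe := hmax₂ x (Finset.mem_erase.2 ⟨fun h => hx (Subtype.ext h), x.2⟩) i
        have h0 : ℓ i x = 0 := le_antisymm (hxe.2 hi₂.le) (hxe.1 hi₂.ge)
        simp [h0]
      have := hle hspan
      simp only [AffineSubspace.mem_comap, AffineSubspace.mem_affineSpan_singleton] at this
      exact hi this

/-- Every point of `X` lies in the convex hull of a flag of centres: it lies between the centre of
its cell and a point of a proper face, reached by following the ray from the centre until it leaves
the cell. -/
theorem exists_flag_mem_convexHull [Finite ι] {X : Set E}
    (hX : ∀ x ∈ X, ∀ y, FaceLE ℓ y x → y ∈ X)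
    (hexit : ∀ x ∈ X, ∀ v : E, v ≠ 0 → ∃ t : ℝ, 0 < t ∧ x + t • v ∉ X)
    (hC : ∀ x ∈ X, ∃ p ∈ C, signVec ℓ p = signVec ℓ x) {x : E} (hx : x ∈ X) :
    ∃ s : Finset E, IsFlag ℓ C s ∧ x ∈ convexHull ℝ (s : Set E) ∧ ∀ y ∈ s, FaceLE ℓ y x := by
  classical
  have := Fintype.ofFinite ι
  induction hN : (Finset.univ.filter fun i => ℓ i x ≠ 0).card using Nat.strong_induction_on
    generalizing x with
  | _ N ih =>
  subst hN
  obtain ⟨p, hpC, hpx⟩ := hC x hx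
  have hpx₁ : FaceLE ℓ p x := FaceLE.of_signVec_eq hpx
  have hpx₂ : FaceLE ℓ x p := FaceLE.of_signVec_eq hpx.symm
  have hpX : p ∈ X := hX x hx p hpx₁
  rcases eq_or_ne x p with rfl | hne
  · exact ⟨{x}, ⟨by simpa using hpC, by simpa using FaceLE.refl x⟩, by simp,
      by simpa using FaceLE.refl x⟩
  have hzero : ∀ i, ℓ i p = 0 → ℓ i x = 0 := fun i h =>
    le_antisymm ((hpx₂ i).2 h.le) ((hpx₂ i).1 h.ge)
  have hneg : ∀ i, ℓ i p < 0 → ℓ i x < 0 := fun i h => by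
    by_contra! h'
    exact absurd ((hpx₁ i).1 h') (not_le.2 h)
  have hpos : ∀ i, 0 < ℓ i p → 0 < ℓ i x := fun i h => by
    by_contra! h'
    exact absurd ((hpx₁ i).2 h') (not_le.2 h)
  obtain ⟨i₁, hi₁, hq₁⟩ : ∃ i, ℓ i p ≠ 0 ∧ ℓ i x / ℓ i p < 1 := by
    by_contra! hcon
    obtain ⟨t, ht, hout⟩ := hexit p hpX (x - p) (sub_ne_zero.2 hne)
    refine hout (hX p hpX _ fun i => ?_)
    have e : ℓ i (p + t • (x - p)) = ℓ i p + t * (ℓ i x - ℓ i p) := by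
      rw [add_comm, ← vadd_eq_add, AffineMap.map_vadd, map_smul, ← vsub_eq_sub x,
        AffineMap.linearMap_vsub]
      simp [add_comm]
    rw [e]
    rcases lt_trichotomy (ℓ i p) 0 with h | h | h
    · have := (one_le_div_of_neg h).1 (hcon i h.ne)
      exact ⟨fun h' => absurd h' (not_le.2 h), fun _ => by nlinarith⟩
    · simp [h, hzero i h]
    · have := (one_le_div h).1 (hcon i h.ne')
      exact ⟨fun _ => by nlinarith, fun h' => absurd h' (not_le.2 h)⟩
  obtain ⟨i₀, hi₀, hmin⟩ := (Finset.univ.filter fun i => ℓ i p ≠ 0).exists_min_image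
    (fun i => ℓ i x / ℓ i p) ⟨i₁, by simpa using hi₁⟩
  simp only [Finset.mem_filter, Finset.mem_univ, true_and] at hi₀ hmin
  set q := ℓ i₀ x / ℓ i₀ p with hq
  have hq1 : q < 1 := (hmin i₁ hi₁).trans_lt hq₁
  have hq0 : 0 < q := by
    rcases lt_or_gt_of_ne hi₀ with h | h
    · exact div_pos_of_neg_of_neg (hneg _ h) h
    · exact div_pos (hpos _ h) h
  have hx0 : ℓ i₀ x = q * ℓ i₀ p := by rw [hq, div_mul_cancel₀ _ hi₀]
  set y := (1 - q)⁻¹ • (x - q • p) with hy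
  have hxy : x = q • p + (1 - q) • y := by
    rw [hy, smul_inv_smul₀ (by linarith)]
    abel
  have hℓ : ∀ i, ℓ i x = q * ℓ i p + (1 - q) * ℓ i y := fun i => by
    conv_lhs => rw [hxy]
    rw [Convex.combo_affine_apply (by ring), smul_eq_mul, smul_eq_mul]
  have hyx : FaceLE ℓ y x := by
    intro i
    have hi := hℓ i
    rcases lt_trichotomy (ℓ i p) 0 with h | h | h
    · have h1 := (le_div_iff_of_neg h).1 (hmin i h.ne)
      have h2 := hneg i h
      refine ⟨fun h' => absurd h' (not_le.2 h2), fun _ => ?_⟩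
      by_contra! hlt
      nlinarith [mul_pos (sub_pos.2 hq1) hlt]
    · have h2 := hzero i h
      have h3 : ℓ i y = 0 := by
        rw [h, h2, mul_zero, zero_add] at hi
        exact (mul_eq_zero.1 hi.symm).resolve_left (by linarith)
      simp [h3]
    · have h1 := (le_div_iff₀ h).1 (hmin i h.ne')
      have h2 := hpos i h
      refine ⟨fun _ => ?_, fun h' => absurd h' (not_le.2 h2)⟩
      by_contra! hlt
      nlinarith [mul_pos (sub_pos.2 hq1) (neg_pos.2 hlt)]
  have hy0 : ℓ i₀ y = 0 := by
    have hi := hℓ i₀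
    rw [hx0] at hi
    have : (1 - q) * ℓ i₀ y = 0 := by linarith
    exact (mul_eq_zero.1 this).resolve_left (by linarith)
  have hcard : (Finset.univ.filter fun i => ℓ i y ≠ 0).card <
      (Finset.univ.filter fun i => ℓ i x ≠ 0).card := by
    refine Finset.card_lt_card ⟨fun i hi => ?_, fun hsub => ?_⟩
    · simp only [Finset.mem_filter, Finset.mem_univ, true_and] at hi ⊢
      exact fun h => hi (le_antisymm ((hyx i).2 h.le) ((hyx i).1 h.ge))
    · have : i₀ ∈ Finset.univ.filter fun i => ℓ i x ≠ 0 := by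
        simp only [Finset.mem_filter, Finset.mem_univ, true_and, hx0]
        exact mul_ne_zero hq0.ne' hi₀
      simpa [hy0] using hsub this
  obtain ⟨s, hs, hys, hsy⟩ := ih _ hcard (hX x hx y hyx) rfl
  have hsp : ∀ z ∈ s, FaceLE ℓ z p := fun z hz => ((hsy z hz).trans hyx).trans hpx₂
  refine ⟨insert p s, ⟨?_, ?_⟩, ?_, ?_⟩
  · intro z hz
    rcases Finset.mem_insert.1 hz with rfl | hz
    · exact hpC
    · exact hs.1 z hz
  · intro z hz w hw
    rcases Finset.mem_insert.1 hz with rfl | hz' <;>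
      rcases Finset.mem_insert.1 hw with rfl | hw'
    · exact Or.inl (FaceLE.refl _)
    · exact Or.inr (hsp w hw')
    · exact Or.inl (hsp z hz')
    · exact hs.2 z hz' w hw'
  · rw [hxy]
    refine convex_convexHull ℝ _ (subset_convexHull ℝ _ (by simp))
      (convexHull_mono (by simp) hys) hq0.le (by linarith) (by ring)
  · intro z hz
    rcases Finset.mem_insert.1 hz with rfl | hz
    · exact hpx₁
    · exact (hsy z hz).trans hyx

/-- A union of cells which is closed under passing to faces and contains no ray is triangulated by
simplices each of which lies in the closure of a cell. -/
theorem exists_triangulation_of_cells [Finite ι] (ℓ : ι → E →ᵃ[ℝ] ℝ) {X : Set E}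
    (hX : ∀ x ∈ X, ∀ y, FaceLE ℓ y x → y ∈ X)
    (hexit : ∀ x ∈ X, ∀ v : E, v ≠ 0 → ∃ t : ℝ, 0 < t ∧ x + t • v ∉ X) :
    ∃ K : Geometry.SimplicialComplex ℝ E, K.faces.Finite ∧ K.space = X ∧
      ∀ s ∈ K.faces, ∃ m ∈ X, ∀ x ∈ convexHull ℝ (s : Set E), FaceLE ℓ x m := by
  classical
  let R : Set (ι → SignType) := signVec ℓ '' X
  have hR : ∀ c : R, ∃ x ∈ X, signVec ℓ x = c := fun c => c.2
  choose ctr hctrX hctr using hR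
  let C : Set E := Set.range ctr
  have hCX : C ⊆ X := by
    rintro _ ⟨c, rfl⟩
    exact hctrX c
  have hC : Set.InjOn (signVec ℓ) C := by
    rintro _ ⟨c, rfl⟩ _ ⟨d, rfl⟩ h
    rw [hctr, hctr] at h
    rw [Subtype.ext h]
  have hC' : ∀ x ∈ X, ∃ p ∈ C, signVec ℓ p = signVec ℓ x := fun x hx =>
    ⟨_, ⟨⟨signVec ℓ x, x, hx, rfl⟩, rfl⟩, hctr _⟩
  have hCfin : C.Finite := Set.finite_range ctr
  let K : Geometry.SimplicialComplex ℝ E :=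
    { faces := {s | IsFlag ℓ C s ∧ s.Nonempty}
      isRelLowerSet_faces := fun s hs => ⟨hs.2, fun t hts ht => ⟨hs.1.mono hts, ht⟩⟩
      indep := fun hs => hs.1.affineIndependent hC
      inter_subset_convexHull := fun hs ht x hx => hs.1.mem_convexHull_inter hC ht.1 hx.1 hx.2 }
  have htop : ∀ s ∈ K.faces, ∃ m ∈ X, ∀ x ∈ convexHull ℝ (s : Set E), FaceLE ℓ x m := by
    intro s hs
    obtain ⟨m, hm, hmax⟩ := hs.1.exists_top hs.2
    exact ⟨m, hCX (hs.1.1 m hm), fun x hx => faceLE_of_mem_convexHull hmax hx⟩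
  refine ⟨K, ?_, ?_, htop⟩
  · exact (hCfin.toFinset.powerset.finite_toSet).subset fun s hs =>
      Finset.mem_coe.2 (Finset.mem_powerset.2 fun x hx => hCfin.mem_toFinset.2 (hs.1.1 x hx))
  · ext x
    rw [Geometry.SimplicialComplex.mem_space_iff]
    constructor
    · rintro ⟨s, hs, hx⟩
      obtain ⟨m, hm, h⟩ := htop s hs
      exact hX m hm x (h x hx)
    · intro hx
      obtain ⟨s, hs, hxs, -⟩ := exists_flag_mem_convexHull hX hexit hC' hx
      exact ⟨s, ⟨hs, Finset.coe_nonempty.1 (convexHull_nonempty_iff.1 ⟨x, hxs⟩)⟩, hxs⟩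

end Triangulation

/-! ### Piecewise linearity through cells -/

/-- The extension of a homeomorphism of the cube by the identity to a permutation of `ℝⁿ`. -/
noncomputable def extendById {n : ℕ} : (cube n ≃ₜ cube n) →* Equiv.Perm (Fin n → ℝ) :=
  open Classical in
  (Equiv.Perm.ofSubtype (p := (· ∈ cube n))).comp
    (MonoidHom.mk' (fun f => f.toEquiv) fun _ _ => rfl)

theorem extendById_coe {n : ℕ} (f : cube n ≃ₜ cube n) (x : cube n) :
    extendById f (x : Fin n → ℝ) = f x :=
  open Classical in Equiv.Perm.ofSubtype_apply_coe f.toEquiv x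

theorem extendById_of_notMem {n : ℕ} (f : cube n ≃ₜ cube n) {x : Fin n → ℝ} (hx : x ∉ cube n) :
    extendById f x = x :=
  open Classical in Equiv.Perm.ofSubtype_apply_of_not_mem f.toEquiv hx

theorem extendById_injective {n : ℕ} : Function.Injective (extendById (n := n)) := by
  intro f g h
  ext x : 1
  exact Subtype.ext (by rw [← extendById_coe, ← extendById_coe, h])

/-- The functionals `x i + 1` and `1 - x i`, whose nonnegativity defines the cube. -/
noncomputable def cubeFunctional {n : ℕ} : Fin n ⊕ Fin n → (Fin n → ℝ) →ᵃ[ℝ] ℝ :=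
  Sum.elim
    (fun i => (LinearMap.proj i : (Fin n → ℝ) →ₗ[ℝ] ℝ).toAffineMap + AffineMap.const ℝ _ 1)
    (fun i => AffineMap.const ℝ _ 1 - (LinearMap.proj i : (Fin n → ℝ) →ₗ[ℝ] ℝ).toAffineMap)

theorem mem_cube_iff {n : ℕ} {x : Fin n → ℝ} : x ∈ cube n ↔ ∀ i, 0 ≤ cubeFunctional i x := by
  constructor
  · rintro h (i | i)
    · have := (h i).1
      simp only [cubeFunctional, Sum.elim_inl, AffineMap.coe_add, LinearMap.coe_toAffineMap,
        AffineMap.coe_const, Pi.add_apply, LinearMap.proj_apply, Function.const_apply]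
      linarith
    · have := (h i).2
      simp only [cubeFunctional, Sum.elim_inr, AffineMap.coe_sub, LinearMap.coe_toAffineMap,
        AffineMap.coe_const, Pi.sub_apply, LinearMap.proj_apply, Function.const_apply]
      linarith
  · intro h i
    have h1 := h (Sum.inl i)
    have h2 := h (Sum.inr i)
    simp only [cubeFunctional, Sum.elim_inr, Sum.elim_inl, AffineMap.coe_add, AffineMap.coe_sub,
      LinearMap.coe_toAffineMap, AffineMap.coe_const, Pi.add_apply, Pi.sub_apply,
      LinearMap.proj_apply, Function.const_apply] at h1 h2
    exact ⟨by linarith, by linarith⟩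

theorem isClosed_cube (n : ℕ) : IsClosed (cube n) := by
  have : cube n = ⋂ i, {x | x i ∈ Set.Icc (-1 : ℝ) 1} := by
    ext x
    simp [cube]
  rw [this]
  exact isClosed_iInter fun i => isClosed_Icc.preimage (continuous_apply i)

theorem exists_add_smul_notMem_cube {n : ℕ} {x v : Fin n → ℝ} (hx : x ∈ cube n) (hv : v ≠ 0) :
    ∃ t : ℝ, 0 < t ∧ x + t • v ∉ cube n := by
  obtain ⟨i, hi⟩ := Function.ne_iff.1 hv
  have hi' : 0 < |v i| := abs_pos.2 hi
  refine ⟨3 / |v i|, by positivity, fun h => ?_⟩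
  have h1 := abs_le.2 (hx i)
  have h2 := abs_le.2 (h i)
  have h3 : |3 / |v i| * v i| = 3 := by
    rw [abs_mul, abs_div, abs_abs, div_mul_cancel₀ _ hi'.ne']
    norm_num
  rw [Pi.add_apply, Pi.smul_apply, smul_eq_mul] at h2
  have h4 := abs_sub_abs_le_abs_sub (3 / |v i| * v i) (-(x i))
  rw [sub_neg_eq_add, abs_neg, h3, add_comm] at h4
  linarith

/-- A simplex is a union of cells of a finite arrangement, namely of the coordinate hyperplanes of
an affine basis containing its vertices. -/
theorem exists_cells_of_simplex {E : Type} [AddCommGroup E] [Module ℝ E] [FiniteDimensional ℝ E]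
    (s : Finset E) (hs : AffineIndependent ℝ ((↑) : s → E)) :
    ∃ (ι : Type) (_ : Finite ι) (ℓ : ι → E →ᵃ[ℝ] ℝ), ∀ x y, signVec ℓ x = signVec ℓ y →
      x ∈ convexHull ℝ (s : Set E) → y ∈ convexHull ℝ (s : Set E) := by
  obtain ⟨t, hst, hti, htt⟩ := exists_subset_affineIndependent_affineSpan_eq_top
    (s := (s : Set E)) hs
  let b : AffineBasis t ℝ E := ⟨(↑), hti, by rw [Subtype.range_coe, htt]⟩
  have hfin : Finite t := (finite_set_of_fin_dim_affineIndependent ℝ hti)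
  have := Fintype.ofFinite t
  refine ⟨t, hfin, b.coord, fun x y hxy hx => ?_⟩
  have hx' : ∀ i, 0 ≤ b.coord i x ∧ ((i : E) ∉ s → b.coord i x = 0) := by
    have hconv : Convex ℝ {x | ∀ i, 0 ≤ b.coord i x ∧ ((i : E) ∉ s → b.coord i x = 0)} := by
      intro x hx y hy a c ha hc hac i
      rw [Convex.combo_affine_apply hac, smul_eq_mul, smul_eq_mul]
      refine ⟨add_nonneg (mul_nonneg ha (hx i).1) (mul_nonneg hc (hy i).1), fun hi => ?_⟩
      rw [(hx i).2 hi, (hy i).2 hi, mul_zero, mul_zero, add_zero]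
    refine convexHull_min (fun z hz => ?_) hconv hx
    intro i
    classical
    have hz' : b ⟨z, hst hz⟩ = z := rfl
    rw [← hz', b.coord_apply]
    refine ⟨by split_ifs <;> norm_num, fun hi => if_neg ?_⟩
    rintro rfl
    exact hi hz
  have hy' : ∀ i, 0 ≤ b.coord i y ∧ ((i : E) ∉ s → b.coord i y = 0) := by
    intro i
    have hi := signVec_eq_iff.1 hxy i
    refine ⟨?_, fun his => ?_⟩
    · rw [← sign_nonneg_iff, ← hi, sign_nonneg_iff]
      exact (hx' i).1
    · rw [← sign_eq_zero_iff, ← hi, sign_eq_zero_iff]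
      exact (hx' i).2 his
  classical
  have hsum :
      ∑ i ∈ Finset.univ.filter (fun i : t => (i : E) ∈ s), b.coord i y • b i = y := by
    rw [Finset.sum_filter_of_ne, b.linear_combination_coord_eq_self]
    intro i _ hi
    by_contra his
    exact hi (by rw [(hy' i).2 his, zero_smul])
  rw [← hsum]
  refine (convex_convexHull ℝ _).sum_mem (fun i _ => (hy' i).1) ?_ fun i hi =>
    subset_convexHull ℝ _ (Finset.mem_filter.1 hi).2
  rw [Finset.sum_filter_of_ne, b.sum_coord_apply_eq_one y]
  intro i _ hi
  by_contra his
  exact hi ((hy' i).2 his)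

theorem IsPL.isCellwiseAffine {n : ℕ} {f : cube n ≃ₜ cube n} (hf : IsPL f) :
    IsCellwiseAffine (extendById f) := by
  obtain ⟨K, ⟨hfin, hspace⟩, hK⟩ := hf
  have : Finite K.faces := hfin
  choose ι hι ℓ hℓ using fun s : K.faces => exists_cells_of_simplex s.1 (K.indep s.2)
  refine ⟨(Σ s, ι s) ⊕ (Fin n ⊕ Fin n), inferInstance,
    Sum.elim (fun p => ℓ p.1 p.2) cubeFunctional, affineOnCells_iff.2 fun x₀ => ?_⟩
  by_cases hx₀ : x₀ ∈ cube n
  · obtain ⟨s, hs, hxs⟩ := Geometry.SimplicialComplex.mem_space_iff.1 (hspace ▸ hx₀)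
    obtain ⟨A, hA⟩ := hK s hs
    refine ⟨A, fun x hx => ?_⟩
    have hx' : x ∈ convexHull ℝ (s : Set (Fin n → ℝ)) := hℓ ⟨s, hs⟩ x₀ x
      (signVec_eq_iff.2 fun i => (signVec_eq_iff.1 hx (Sum.inl ⟨⟨s, hs⟩, i⟩)).symm) hxs
    have hxc : x ∈ cube n := hspace ▸ Geometry.SimplicialComplex.convexHull_subset_space hs hx'
    exact (extendById_coe f ⟨x, hxc⟩).trans (hA ⟨x, hxc⟩ hx')
  · refine ⟨AffineMap.id ℝ _, fun x hx => extendById_of_notMem f fun hxc => hx₀ ?_⟩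
    rw [mem_cube_iff] at hxc ⊢
    intro i
    have hi := signVec_eq_iff.1 hx (Sum.inr i)
    simp only [Sum.elim_inr] at hi
    rw [← sign_nonneg_iff, ← hi, sign_nonneg_iff]
    exact hxc i

theorem continuousOn_extendById {n : ℕ} (f : cube n ≃ₜ cube n) :
    ContinuousOn (extendById f) (cube n) := by
  rw [continuousOn_iff_continuous_domRestrict]
  exact (continuous_subtype_val.comp f.continuous).congr fun x => (extendById_coe f x).symm

open Filter Topology in
/-- The arrangement is enlarged by the facets of the cube and the cube triangulated by flags of
cells; affinity extends from the cells to the closed simplices by continuity. -/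
theorem IsCellwiseAffine.isPL {n : ℕ} {f : cube n ≃ₜ cube n}
    (hf : IsCellwiseAffine (extendById f)) : IsPL f := by
  obtain ⟨ι, _, ℓ, hℓ⟩ := hf
  let ℓ' : ι ⊕ (Fin n ⊕ Fin n) → (Fin n → ℝ) →ᵃ[ℝ] ℝ := Sum.elim ℓ cubeFunctional
  have hℓ' : AffineOnCells ℓ' (extendById f) := hℓ.refine fun x y hxy =>
    signVec_eq_iff.2 fun i => signVec_eq_iff.1 hxy (Sum.inl i)
  have hcube : ∀ x ∈ cube n, ∀ y, FaceLE ℓ' y x → y ∈ cube n := fun x hx y hyx =>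
    mem_cube_iff.2 fun i => (hyx (Sum.inr i)).1 (mem_cube_iff.1 hx i)
  obtain ⟨K, hfin, hspace, hK⟩ := exists_triangulation_of_cells ℓ' hcube
    fun x hx v hv => exists_add_smul_notMem_cube hx hv
  refine ⟨K, ⟨hfin, hspace⟩, fun s hs => ?_⟩
  obtain ⟨m, hm, hsm⟩ := hK s hs
  obtain ⟨A, hA⟩ := affineOnCells_iff.1 hℓ' m
  refine ⟨A, fun x hx => ?_⟩
  let γ : ℝ → Fin n → ℝ := fun t => t • m + (1 - t) • (x : Fin n → ℝ)
  have hγ : Tendsto γ (𝓝[>] 0) (𝓝 x) := by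
    have : Continuous γ := by fun_prop
    simpa [γ] using (this.tendsto 0).mono_left nhdsWithin_le_nhds
  have hev : ∀ᶠ t in 𝓝[>] (0 : ℝ), signVec ℓ' (γ t) = signVec ℓ' m := by
    filter_upwards [Ioo_mem_nhdsGT one_pos] with t ht
    exact signVec_combo (hsm x hx) ht.1 (by linarith [ht.2]) (by ring)
  have h1 : Tendsto (extendById f ∘ γ) (𝓝[>] 0) (𝓝 (extendById f x)) := by
    refine (continuousOn_extendById f x x.2).tendsto.comp
      (tendsto_nhdsWithin_iff.2 ⟨hγ, hev.mono fun t ht => ?_⟩)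
    exact hcube m hm _ (FaceLE.of_signVec_eq ht)
  have h2 : Tendsto (A ∘ γ) (𝓝[>] 0) (𝓝 (A x)) :=
    (A.continuous_of_finiteDimensional.tendsto _).comp hγ
  rw [← extendById_coe]
  exact tendsto_nhds_unique (h1.congr' (hev.mono fun t ht => hA _ ht)) h2

theorem FixesBoundary.continuous_extendById {n : ℕ} {f : cube n ≃ₜ cube n}
    (hf : FixesBoundary f) : Continuous (extendById f) := by
  have h2 : ContinuousOn (extendById f) (closure (cube n)ᶜ) := by
    refine continuousOn_id.congr fun x hx => ?_
    by_cases hxc : x ∈ cube n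
    · have : x ∈ frontier (cube n) := by
        rw [frontier_eq_closure_inter_closure]
        exact ⟨subset_closure hxc, hx⟩
      exact (extendById_coe f ⟨x, hxc⟩).trans (congrArg Subtype.val (hf ⟨x, hxc⟩ this))
    · exact extendById_of_notMem f hxc
  have h3 := (continuousOn_extendById f).union_of_isClosed h2 (isClosed_cube n) isClosed_closure
  have h4 : cube n ∪ closure (cube n)ᶜ = Set.univ := by
    refine Set.eq_univ_of_forall fun x => ?_
    by_cases hx : x ∈ cube n
    · exact Or.inl hx
    · exact Or.inr (subset_closure hx)
  rwa [h4, continuousOn_univ] at h3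

/-- The group `PL(Iⁿ, ∂Iⁿ)`, with piecewise linearity expressed through cells. -/
noncomputable def plGroup (n : ℕ) : Subgroup (cube n ≃ₜ cube n) where
  carrier := {f | IsCellwiseAffine (extendById f) ∧ FixesBoundary f}
  mul_mem' := by
    rintro f g ⟨hf, hf'⟩ ⟨hg, hg'⟩
    refine ⟨?_, fun x hx => ?_⟩
    · rw [map_mul, Equiv.Perm.coe_mul]
      exact hf.comp hg
    · rw [Homeomorph.mul_apply, hg' x hx, hf' x hx]
  one_mem' := by
    refine ⟨?_, fun x _ => rfl⟩
    rw [map_one, Equiv.Perm.coe_one]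
    exact isCellwiseAffine_id
  inv_mem' := by
    rintro f ⟨hf, hf'⟩
    refine ⟨?_, fun x hx => ?_⟩
    · rw [map_inv]
      exact hf.symm
    · exact f.symm_apply_eq.2 (hf' x hx).symm

theorem mem_plGroup {n : ℕ} {f : cube n ≃ₜ cube n} :
    f ∈ plGroup n ↔ IsPL f ∧ FixesBoundary f :=
  and_congr_left fun _ => ⟨fun h => h.isPL, fun h => h.isCellwiseAffine⟩

/-! ### Germs of shears -/

/-- Near the zero `p` of `L`, the map `F` is the identity on the half-space `L ≤ 0` and the affine
map `x ↦ x + L x • v` on the half-space `L ≥ 0`, which it preserves. -/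
def HasShearGerm {E : Type*} [NormedAddCommGroup E] [NormedSpace ℝ E] (L : E →ᵃ[ℝ] ℝ) (p : E)
    (F : E → E) (v : E) : Prop :=
  0 < 1 + L.linear v ∧ ∀ᶠ x in nhds p, F x = x + max (L x) 0 • v

section Germs

open Filter Topology

variable {E : Type*} [NormedAddCommGroup E] [NormedSpace ℝ E]

theorem AffineMap.apply_add_smul (L : E →ᵃ[ℝ] ℝ) (x v : E) (t : ℝ) :
    L (x + t • v) = L x + t * L.linear v := by
  rw [add_comm, ← vadd_eq_add, AffineMap.map_vadd, map_smul, vadd_eq_add, smul_eq_mul, add_comm]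

theorem max_apply_shear {L : E →ᵃ[ℝ] ℝ} {v : E} (hv : 0 < 1 + L.linear v) (x : E) :
    max (L (x + max (L x) 0 • v)) 0 = (1 + L.linear v) * max (L x) 0 := by
  rw [AffineMap.apply_add_smul]
  rcases le_total (L x) 0 with h | h
  · rw [max_eq_right h, zero_mul, add_zero, mul_zero, max_eq_right h]
  · rw [max_eq_left h, max_eq_left]
    · ring
    · nlinarith

theorem AffineMap.exists_linear_eq_one {L : E →ᵃ[ℝ] ℝ} (hL : L.linear ≠ 0) :
    ∃ w, L.linear w = 1 := by
  obtain ⟨u, hu⟩ : ∃ u, L.linear u ≠ 0 := by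
    by_contra! h
    exact hL (LinearMap.ext h)
  exact ⟨(L.linear u)⁻¹ • u, by rw [map_smul, smul_eq_mul, inv_mul_cancel₀ hu]⟩

theorem tendsto_add_smul_nhds_zero (x w : E) :
    Tendsto (fun t : ℝ => x + t • w) (𝓝[>] 0) (𝓝 x) := by
  have : Continuous fun t : ℝ => x + t • w := by fun_prop
  simpa using (this.tendsto 0).mono_left nhdsWithin_le_nhds

theorem AffineMap.eq_of_eqOn_isOpen {F : Type*} [AddCommGroup F] [Module ℝ F] {A B : E →ᵃ[ℝ] F}
    {O : Set E} (hO : IsOpen O) (hne : O.Nonempty) (h : Set.EqOn A B O) : A = B :=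
  AffineMap.ext_on (hO.affineSpan_eq_top hne) h

variable {L : E →ᵃ[ℝ] ℝ} {p : E}

theorem HasShearGerm.unique (hp : L p = 0) (hL : L.linear ≠ 0) {F : E → E} {v w : E}
    (hv : HasShearGerm L p F v) (hw : HasShearGerm L p F w) : v = w := by
  obtain ⟨u, hu⟩ := AffineMap.exists_linear_eq_one hL
  obtain ⟨t, ⟨h1, h2⟩, ht⟩ := (((tendsto_add_smul_nhds_zero p u).eventually
    (hv.2.and hw.2)).and self_mem_nhdsWithin).exists
  have ht' : (0 : ℝ) < t := ht
  have h3 : L (p + t • u) = t := by rw [AffineMap.apply_add_smul, hp, hu]; ring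
  rw [h1, h3, max_eq_left ht'.le] at h2
  exact smul_right_injective E ht'.ne' (add_left_cancel h2)

theorem eqOn_hyperplane_of_eqOn_side (hL : L.linear ≠ 0) {F G : E → E} (hF : Continuous F)
    (hG : Continuous G) {r : ℝ} (h : ∀ x ∈ Metric.ball p r, 0 < L x → F x = G x) :
    ∀ x ∈ Metric.ball p r, L x = 0 → F x = G x := by
  intro x hx hx0
  obtain ⟨w, hw⟩ := AffineMap.exists_linear_eq_one hL
  have ht := tendsto_add_smul_nhds_zero x w
  refine tendsto_nhds_unique_of_eventuallyEq ((hF.tendsto x).comp ht) ((hG.tendsto x).comp ht) ?_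
  filter_upwards [ht.eventually (Metric.isOpen_ball.mem_nhds hx), self_mem_nhdsWithin] with t h1 h2
  refine h _ h1 ?_
  have h2' : (0 : ℝ) < t := h2
  rw [AffineMap.apply_add_smul, hx0, hw]
  linarith

/-- An affine map fixing a hyperplane near one of its points is a shear or a dilation along it. -/
theorem AffineMap.exists_eq_add_smul (hL : L.linear ≠ 0) (hp : L p = 0) {A : E →ᵃ[ℝ] E} {r : ℝ}
    (hr : 0 < r) (hA : ∀ x ∈ Metric.ball p r, L x = 0 → A x = x) :
    ∃ v, ∀ x, A x = x + L x • v := by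
  obtain ⟨w, hw⟩ := AffineMap.exists_linear_eq_one hL
  have hAp : A p = p := hA p (Metric.mem_ball_self hr) hp
  have hker : ∀ u, L.linear u = 0 → A.linear u = u := by
    intro u hu
    obtain ⟨t, h1, h2⟩ := (((tendsto_add_smul_nhds_zero p u).eventually
      (Metric.isOpen_ball.mem_nhds (Metric.mem_ball_self hr))).and self_mem_nhdsWithin).exists
    have h2' : (0 : ℝ) < t := h2
    have h3 := hA _ h1 (by rw [AffineMap.apply_add_smul, hp, hu, mul_zero, add_zero])
    rw [add_comm, ← vadd_eq_add, AffineMap.map_vadd, hAp, map_smul] at h3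
    exact smul_right_injective E h2'.ne' (add_right_cancel h3)
  refine ⟨A.linear w - w, fun x => ?_⟩
  have h1 : L.linear (x - p) = L x := by
    rw [← vsub_eq_sub, AffineMap.linearMap_vsub, hp, vsub_eq_sub, sub_zero]
  have h2 := hker (x - p - L x • w) (by rw [map_sub, map_smul, h1, hw, smul_eq_mul]; ring)
  have h3 : A x = A.linear (x - p) + p := by
    rw [← vsub_eq_sub, AffineMap.linearMap_vsub, hAp, vsub_eq_sub, sub_add_cancel]
  rw [map_sub, map_smul] at h2
  rw [h3, eq_add_of_sub_eq h2, smul_sub]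
  abel

variable [FiniteDimensional ℝ E]

theorem tendsto_shear (hp : L p = 0) (v : E) :
    Tendsto (fun x => x + max (L x) 0 • v) (𝓝 p) (𝓝 p) := by
  have hL : Continuous L := L.continuous_of_finiteDimensional
  have : Continuous fun x => x + max (L x) 0 • v := by fun_prop
  simpa [hp] using this.tendsto p

theorem HasShearGerm.comp (hp : L p = 0) {F G : E → E} {v w : E} (hF : HasShearGerm L p F v)
    (hG : HasShearGerm L p G w) :
    HasShearGerm L p (F ∘ G) (w + (1 + L.linear w) • v) := by
  refine ⟨?_, ?_⟩
  · have := mul_pos hF.1 hG.1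
    rw [map_add, map_smul, smul_eq_mul]
    linarith
  · filter_upwards [hG.2, (tendsto_shear hp w).eventually hF.2] with x h1 h2
    rw [Function.comp_apply, h1, h2, max_apply_shear hG.1, add_assoc, smul_add, smul_smul,
      mul_comm]

theorem HasShearGerm.symm (hp : L p = 0) {F : Equiv.Perm E} {v : E}
    (hF : HasShearGerm L p F v) : HasShearGerm L p F.symm (-(1 + L.linear v)⁻¹ • v) := by
  have hv := hF.1
  have h1 : 1 + L.linear (-(1 + L.linear v)⁻¹ • v) = (1 + L.linear v)⁻¹ := by
    rw [map_smul, smul_eq_mul]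
    field_simp
    ring
  have h1' : 0 < 1 + L.linear (-(1 + L.linear v)⁻¹ • v) := by
    rw [h1]
    exact inv_pos.2 hv
  refine ⟨h1', ?_⟩
  filter_upwards [(tendsto_shear hp _).eventually hF.2] with x hx
  rw [Equiv.symm_apply_eq, hx, max_apply_shear h1', h1, smul_smul, add_assoc, ← add_smul]
  have : max (L x) 0 * -(1 + L.linear v)⁻¹ + (1 + L.linear v)⁻¹ * max (L x) 0 = 0 := by ring
  rw [this, zero_smul, add_zero]

/-! ### A point where a finite family of maps has nontrivial germs -/

theorem exists_mem_forall_ne_zero {κ : Type*} [Finite κ] (m : κ → E →ᵃ[ℝ] ℝ) {O : Set E}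
    (hO : IsOpen O) (hne : O.Nonempty) : ∃ a ∈ O, ∀ k, m k ≠ 0 → m k a ≠ 0 := by
  have := FiniteDimensional.complete ℝ E
  have hd : Dense (⋂ k : {k // m k ≠ 0}, {x | m k x ≠ 0}) := by
    refine dense_iInter_of_isOpen (fun k => ?_) fun k => ?_
    · exact isOpen_ne_fun (m k).continuous_of_finiteDimensional continuous_const
    · refine dense_iff_inter_open.2 fun U hU hUne => ?_
      by_contra hcon
      refine k.2 (AffineMap.eq_of_eqOn_isOpen hU hUne fun x hx => ?_)
      by_contra hx0
      exact hcon ⟨x, hx, hx0⟩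
  obtain ⟨a, haO, ha⟩ := hd.inter_open_nonempty O hO hne
  exact ⟨a, haO, fun k hk => Set.mem_iInter.1 ha ⟨k, hk⟩⟩

/-- Two nonempty open sets can be joined by a segment in general position: at each of its points
all the functionals that vanish are multiples of a single nonconstant one. -/
theorem exists_generic_segment [Nontrivial E] {ι : Type*} [Finite ι] (ℓ : ι → E →ᵃ[ℝ] ℝ)
    {O₁ O₂ : Set E} (hO₁ : IsOpen O₁) (hne₁ : O₁.Nonempty) (hO₂ : IsOpen O₂)
    (hne₂ : O₂.Nonempty) :
    ∃ a ∈ O₁, ∃ b ∈ O₂, ∀ p ∈ segment ℝ a b, ∃ L : E →ᵃ[ℝ] ℝ, L.linear ≠ 0 ∧ L p = 0 ∧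
      ∀ i, ℓ i p = 0 → ∃ c : ℝ, ℓ i = c • L := by
  obtain ⟨a, ha, ha'⟩ := exists_mem_forall_ne_zero ℓ hO₁ hne₁
  -- The functional `m (i, j)` vanishes at `a` and wherever both `ℓ i` and `ℓ j` vanish. If it is
  -- nonzero at `b`, then the segment does not meet the subspace `ℓ i = ℓ j = 0`.
  let m : ι × ι → E →ᵃ[ℝ] ℝ := fun k => ℓ k.2 a • ℓ k.1 - ℓ k.1 a • ℓ k.2
  obtain ⟨b, hb, hb'⟩ := exists_mem_forall_ne_zero m hO₂ hne₂
  refine ⟨a, ha, b, hb, fun p hp => ?_⟩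
  by_cases hj : ∃ j, ℓ j ≠ 0 ∧ ℓ j p = 0
  · obtain ⟨j, hj, hjp⟩ := hj
    refine ⟨ℓ j, fun h => hj ?_, hjp, fun i hip => ⟨ℓ i a / ℓ j a, ?_⟩⟩
    · ext x
      have := (ℓ j).linearMap_vsub x p
      rw [h, LinearMap.zero_apply, hjp] at this
      simpa using this.symm
    · have hja := ha' j hj
      have hm : m (i, j) = 0 := by
        by_contra hm
        obtain ⟨s, t, -, -, hst, rfl⟩ := hp
        have h1 : m (i, j) (s • a + t • b) = 0 := by simp [m, hip, hjp]
        have h2 : m (i, j) a = 0 := by simp [m, mul_comm]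
        rw [Convex.combo_affine_apply hst, h2, smul_zero, zero_add, smul_eq_mul] at h1
        rcases mul_eq_zero.1 h1 with rfl | h1
        · obtain rfl : s = 1 := by linarith
          simp only [one_smul, zero_smul, add_zero] at hjp
          exact hja hjp
        · exact hb' (i, j) hm h1
      have h3 : ℓ j a • ℓ i = ℓ i a • ℓ j := sub_eq_zero.1 hm
      rw [div_eq_inv_mul, mul_smul, ← h3, inv_smul_smul₀ hja]
  · push Not at hj
    obtain ⟨φ, hφ⟩ := exists_ne (0 : Module.Dual ℝ E)
    refine ⟨φ.toAffineMap - AffineMap.const ℝ E (φ p), ?_, by simp, fun i hip => ⟨0, ?_⟩⟩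
    · simpa using hφ
    · rw [zero_smul]
      by_contra h
      exact hj i h hip

/-- Near a point `p` of general position, a cellwise affine map is affine on each side of the
hyperplane `L = 0`. -/
theorem exists_ball_affine_on_side {ι : Type*} [Finite ι] {ℓ : ι → E →ᵃ[ℝ] ℝ}
    (hL : ∀ i, ℓ i p = 0 → ∃ c : ℝ, ℓ i = c • L) :
    ∃ r > 0, ∀ F : E → E, AffineOnCells ℓ F →
      (∃ A : E →ᵃ[ℝ] E, ∀ x ∈ Metric.ball p r, 0 < L x → F x = A x) ∧
      (∃ A : E →ᵃ[ℝ] E, ∀ x ∈ Metric.ball p r, L x < 0 → F x = A x) := by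
  have hev : ∀ᶠ x in 𝓝 p, ∀ i, ℓ i p ≠ 0 → SignType.sign (ℓ i x) = SignType.sign (ℓ i p) := by
    rw [eventually_all]
    intro i
    by_cases hi : ℓ i p = 0
    · simp [hi]
    · exact (eventually_sign_eq hi ((ℓ i).continuous_of_finiteDimensional.tendsto p)).mono
        fun x hx _ => hx
  obtain ⟨r, hr, hball⟩ := Metric.eventually_nhds_iff_ball.1 hev
  have key : ∀ x ∈ Metric.ball p r, ∀ y ∈ Metric.ball p r,
      SignType.sign (L x) = SignType.sign (L y) → signVec ℓ x = signVec ℓ y := by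
    intro x hx y hy hxy
    refine signVec_eq_iff.2 fun i => ?_
    by_cases hi : ℓ i p = 0
    · obtain ⟨c, hc⟩ := hL i hi
      simp [hc, sign_mul, hxy]
    · rw [hball x hx i hi, hball y hy i hi]
  refine ⟨r, hr, fun F hF => ?_⟩
  have side : ∀ σ : SignType, ∃ A : E →ᵃ[ℝ] E, ∀ x ∈ Metric.ball p r,
      SignType.sign (L x) = σ → F x = A x := by
    intro σ
    by_cases hσ : ∃ x₀ ∈ Metric.ball p r, SignType.sign (L x₀) = σ
    · obtain ⟨x₀, hx₀, rfl⟩ := hσ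
      obtain ⟨A, hA⟩ := affineOnCells_iff.1 hF x₀
      exact ⟨A, fun x hx hxσ => hA x (key x hx x₀ hx₀ hxσ)⟩
    · exact ⟨AffineMap.id ℝ E, fun x hx hxσ => absurd ⟨x, hx, hxσ⟩ hσ⟩
  obtain ⟨A, hA⟩ := side 1
  obtain ⟨B, hB⟩ := side (-1)
  exact ⟨⟨A, fun x hx h => hA x hx (sign_pos h)⟩, ⟨B, fun x hx h => hB x hx (sign_neg h)⟩⟩

/-- An injective map which near `p` is the identity for `L ≤ 0` and `x ↦ x + L x • v` for `L ≥ 0`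
does not fold the second half-space onto the first, by injectivity. -/
theorem hasShearGerm_of_injective (hL : L.linear ≠ 0) (hp : L p = 0) {F : E → E}
    (hF : Function.Injective F) {v : E} (h : ∀ᶠ x in 𝓝 p, F x = x + max (L x) 0 • v) :
    HasShearGerm L p F v := by
  refine ⟨?_, h⟩
  by_contra! hle
  obtain ⟨w, hw⟩ := AffineMap.exists_linear_eq_one hL
  have ht := tendsto_add_smul_nhds_zero p w
  obtain ⟨t, ⟨h1, h2⟩, h3⟩ := ((ht.eventually (h.and ((tendsto_shear hp v).eventually h))).and
    self_mem_nhdsWithin).exists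
  have h3' : (0 : ℝ) < t := h3
  have hLt : L (p + t • w) = t := by rw [AffineMap.apply_add_smul, hp, hw]; ring
  rw [hLt, max_eq_left h3'.le] at h1 h2
  have h4 : L (p + t • w + t • v) ≤ 0 := by
    rw [AffineMap.apply_add_smul, hLt]
    nlinarith
  rw [max_eq_right h4, zero_smul, add_zero, ← h1] at h2
  have h5 := hF h2
  rw [h1, add_eq_left, smul_eq_zero] at h5
  rw [h5.resolve_left h3'.ne', map_zero] at hle
  linarith

/-- A finite family of continuous cellwise affine permutations, not all trivial but all fixing a
common open set, has simultaneous shear germs, not all trivial, at a generic point of the frontier of the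
interior of the common fixed set. -/
theorem exists_shear_germs [Nontrivial E] {J : Type} [Finite J] {F : J → Equiv.Perm E}
    (hPA : ∀ j, IsCellwiseAffine (F j)) (hcont : ∀ j, Continuous (F j)) {O : Set E}
    (hO : IsOpen O) (hne : O.Nonempty) (hfix : ∀ j, ∀ x ∈ O, F j x = x) (hmov : ∃ j, F j ≠ 1) :
    ∃ (L : E →ᵃ[ℝ] ℝ) (p : E), L.linear ≠ 0 ∧ L p = 0 ∧ ∃ v : J → E,
      (∀ j, HasShearGerm L p (F j) (v j)) ∧ ∃ j, v j ≠ 0 := by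
  obtain ⟨ι, _, ℓ, hℓ⟩ := exists_common_cells (F := fun j => (F j : E → E)) hPA
  set U := interior {x | ∀ j, F j x = x} with hU
  have hOU : O ⊆ U := interior_maximal (fun x hx j => hfix j x hx) hO
  have hUfix : ∀ x ∈ U, ∀ j, F j x = x := fun x hx => interior_subset hx
  obtain ⟨j₀, hj₀⟩ := hmov
  obtain ⟨a, ha, b, hb, hab⟩ := exists_generic_segment ℓ hO hne
    (isOpen_ne_fun (hcont j₀) continuous_id) (by
      by_contra hcon
      refine hj₀ (Equiv.ext fun x => ?_)
      by_contra hx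
      exact hcon ⟨x, hx⟩)
  obtain ⟨p, hpab, hpU⟩ : ∃ p ∈ segment ℝ a b, p ∈ frontier U := by
    by_contra! hcon
    have hsub : segment ℝ a b ⊆ U := by
      refine (convex_segment a b).isPreconnected.subset_left_of_subset_union isOpen_interior
        (isClosed_closure (s := U)).isOpen_compl ?_ ?_ ⟨a, left_mem_segment ℝ a b, hOU ha⟩
      · exact Set.disjoint_compl_right_iff_subset.2 subset_closure
      · intro x hx
        by_cases hxU : x ∈ U
        · exact Or.inl hxU
        · refine Or.inr fun hxc => hcon x hx ⟨hxc, ?_⟩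
          rwa [isOpen_interior.interior_eq]
    exact hb (hUfix b (hsub (right_mem_segment ℝ a b)) j₀)
  have hpU' : p ∉ U := by
    have := hpU.2
    rwa [isOpen_interior.interior_eq] at this
  obtain ⟨L₀, hL₀, hL₀p, hL₀ℓ⟩ := hab p hpab
  -- The sign of the functional is chosen so that fixed points accumulate on its negative side.
  obtain ⟨L, hL, hLp, r, hr, haff, x₁, hx₁U, hx₁r, hx₁⟩ : ∃ L : E →ᵃ[ℝ] ℝ, L.linear ≠ 0 ∧
      L p = 0 ∧ ∃ r > 0, (∀ j, (∃ A : E →ᵃ[ℝ] E, ∀ x ∈ Metric.ball p r, 0 < L x → F j x = A x) ∧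
        ∃ A : E →ᵃ[ℝ] E, ∀ x ∈ Metric.ball p r, L x < 0 → F j x = A x) ∧
      ∃ x ∈ U, x ∈ Metric.ball p r ∧ L x < 0 := by
    obtain ⟨r, hr, haff⟩ := exists_ball_affine_on_side hL₀ℓ
    obtain ⟨x, hx, hx0⟩ := exists_mem_forall_ne_zero (fun _ : Unit => L₀)
      (Metric.isOpen_ball.inter isOpen_interior)
      (mem_closure_iff.1 hpU.1 _ Metric.isOpen_ball (Metric.mem_ball_self hr))
    have hx0' : L₀ x ≠ 0 := hx0 () fun h => hL₀ (by rw [h]; rfl)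
    rcases lt_or_gt_of_ne hx0' with h | h
    · exact ⟨L₀, hL₀, hL₀p, r, hr, fun j => haff _ (hℓ j), x, hx.2, hx.1, h⟩
    · refine ⟨-L₀, ?_, ?_, r, hr, fun j => ⟨?_, ?_⟩, x, hx.2, hx.1, ?_⟩
      · rwa [AffineMap.neg_linear, neg_ne_zero]
      · simp [hL₀p]
      · obtain ⟨A, hA⟩ := (haff _ (hℓ j)).2
        exact ⟨A, fun x hx h => hA x hx (by simpa using h)⟩
      · obtain ⟨A, hA⟩ := (haff _ (hℓ j)).1
        exact ⟨A, fun x hx h => hA x hx (by simpa using h)⟩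
      · simpa using h
  have hLc : Continuous L := L.continuous_of_finiteDimensional
  have hneg : ∀ j, ∀ x ∈ Metric.ball p r, L x < 0 → F j x = x := by
    intro j
    obtain ⟨A, hA⟩ := (haff j).2
    have : A = AffineMap.id ℝ E := by
      refine AffineMap.eq_of_eqOn_isOpen (O := Metric.ball p r ∩ U ∩ {x | L x < 0})
        ((Metric.isOpen_ball.inter isOpen_interior).inter (isOpen_lt hLc continuous_const))
        ⟨x₁, ⟨hx₁r, hx₁U⟩, hx₁⟩ ?_
      rintro x ⟨⟨hxr, hxU⟩, hx⟩
      rw [← hA x hxr hx, hUfix x hxU j, AffineMap.id_apply]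
    intro x hxr hx
    rw [hA x hxr hx, this, AffineMap.id_apply]
  have hzero : ∀ j, ∀ x ∈ Metric.ball p r, L x = 0 → F j x = x := by
    intro j x hxr hx
    refine eqOn_hyperplane_of_eqOn_side (L := -L) ?_ (hcont j) continuous_id
      (fun x hxr hx => hneg j x hxr (by simpa using hx)) x hxr (by simpa using hx)
    rwa [AffineMap.neg_linear, neg_ne_zero]
  have hshear : ∀ j, ∃ v, ∀ x ∈ Metric.ball p r, F j x = x + max (L x) 0 • v := by
    intro j
    obtain ⟨A, hA⟩ := (haff j).1
    have hA0 := eqOn_hyperplane_of_eqOn_side hL (hcont j) A.continuous_of_finiteDimensional hA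
    obtain ⟨v, hv⟩ := AffineMap.exists_eq_add_smul hL hLp (A := A) hr fun x hxr hx =>
      (hA0 x hxr hx).symm.trans (hzero j x hxr hx)
    refine ⟨v, fun x hxr => ?_⟩
    rcases lt_trichotomy (L x) 0 with h | h | h
    · rw [hneg j x hxr h, max_eq_right h.le, zero_smul, add_zero]
    · rw [hzero j x hxr h, h, max_self, zero_smul, add_zero]
    · rw [hA x hxr h, hv, max_eq_left h.le]
  choose v hv using hshear
  refine ⟨L, p, hL, hLp, v, fun j => hasShearGerm_of_injective hL hLp (F j).injective
    (Filter.eventually_of_mem (Metric.ball_mem_nhds p hr) (hv j)), ?_⟩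
  by_contra! hv0
  refine hpU' (interior_maximal (fun x hx j => ?_) Metric.isOpen_ball (Metric.mem_ball_self hr))
  rw [hv j x hx, hv0 j, smul_zero, add_zero]

end Germs

/-! ### The group of piecewise linear homeomorphisms -/

/-- The germs of a finitely generated subgroup at a point given by `exists_shear_germs` for its
generators form a nontrivial group of shears and dilations, which surjects onto `ℤ`. -/
theorem isLocallyIndicable_plGroup {n : ℕ} (hn : 1 ≤ n) : IsLocallyIndicable (plGroup n) := by
  intro H hfg hne
  obtain ⟨S, rfl⟩ := hfg
  have : Nonempty (Fin n) := ⟨⟨0, hn⟩⟩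
  let F : plGroup n →* Equiv.Perm (Fin n → ℝ) := extendById.comp (plGroup n).subtype
  have hF : Function.Injective F := extendById_injective.comp Subtype.val_injective
  have hmov : ∃ s : S, F s ≠ 1 := by
    by_contra! hcon
    refine hne ((Subgroup.closure_eq_bot_iff).2 fun s hs => ?_)
    exact hF ((hcon ⟨s, hs⟩).trans (map_one F).symm)
  obtain ⟨L, p, hL, hLp, v, hv, s₀, hs₀⟩ := exists_shear_germs (F := fun s : S => F s)
    (fun s => s.1.2.1) (fun s => s.1.2.2.continuous_extendById)
    (isClosed_cube n).isOpen_compl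
    ⟨fun _ => 2, fun h => by have := (h ⟨0, hn⟩).2; norm_num at this⟩
    (fun s x hx => extendById_of_notMem s.1.1 hx) hmov
  have hgerm : ∀ h ∈ Subgroup.closure (S : Set (plGroup n)), ∃ w, HasShearGerm L p (F h) w := by
    intro h hh
    induction hh using Subgroup.closure_induction with
    | mem s hs => exact ⟨_, hv ⟨s, hs⟩⟩
    | one =>
      refine ⟨0, by simp, Filter.Eventually.of_forall fun x => ?_⟩
      rw [map_one, Equiv.Perm.one_apply, smul_zero, add_zero]
    | mul g h _ _ hg hh =>
      obtain ⟨w, hw⟩ := hg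
      obtain ⟨w', hw'⟩ := hh
      exact ⟨_, by simpa only [map_mul, Equiv.Perm.coe_mul] using hw.comp hLp hw'⟩
    | inv g _ hg =>
      obtain ⟨w, hw⟩ := hg
      exact ⟨_, by rw [map_inv]; exact hw.symm hLp⟩
  choose w hw using hgerm
  have : Group.FG (Subgroup.closure (S : Set (plGroup n))) :=
    (Group.fg_iff_subgroup_fg _).2 ⟨S, rfl⟩
  refine exists_surjective_int_of_cocycle L.linear
    (fun h : Subgroup.closure (S : Set (plGroup n)) => w h.1 h.2) (fun h => (hw h.1 h.2).1)
    (fun h g => ?_) ⟨⟨s₀, Subgroup.subset_closure s₀.2⟩, ?_⟩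
  · refine (hw (h * g).1 (h * g).2).unique hLp hL ?_
    simpa only [Subgroup.coe_mul, map_mul, Equiv.Perm.coe_mul] using
      (hw h.1 h.2).comp hLp (hw g.1 g.2)
  · rw [(hw _ _).unique hLp hL (hv s₀)]
    exact hs₀

/-- For `n ≥ 1` the piecewise-linear homeomorphisms of `Iⁿ` that fix the boundary pointwise form
a group `PL(Iⁿ, ∂Iⁿ)` under composition; it is locally indicable and left-orderable. -/
theorem mainTheorem12 (n : ℕ) (hn : 1 ≤ n) :
    ∃ PL : Subgroup (cube n ≃ₜ cube n),
      (∀ f : cube n ≃ₜ cube n, f ∈ PL ↔ IsPL f ∧ FixesBoundary f) ∧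
      IsLocallyIndicable PL ∧ IsLeftOrderable PL :=
  ⟨plGroup n, fun _ => mem_plGroup, isLocallyIndicable_plGroup hn,
    (isLocallyIndicable_plGroup hn).isLeftOrderable⟩
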